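/- Let $k$ be a field, let $Q$ be a finite quiver without oriented cycles, $kQ$ its path algebra and $\Lambda=kQ[\epsilon]=kQ[T]/\langle T^2\rangle$ with $T$ a central variable. Thus a $\Lambda$-module is a $kQ$-module $M$ together with an endomorphism $\epsilon$ satisfying $\epsilon^2=0$, and $kQ$-modules are regarded as the $\Lambda$-modules annihilated by $\epsilon$. Let $\mathcal L$ be the category of finitely generated torsionless $\Lambda$-modules (those which embed into a projective $\Lambda$-module), $\mathcal P$ the class of finitely generated projective $\Lambda$-modules, and let $H$ be the homology functor $H(M)=\operatorname{Ker}\epsilon/\operatorname{Im}\epsilon$. A map $g:X\to M$ is a minimal right $\mathcal L$-approximation of $M$ if $X\in\mathcal L$, every map $L\to M$ with $L\in\mathcal L$ factors through $g$, and every endomorphism $\varphi$ of $X$ with $g\varphi=g$ is an automorphism. **Theorem 2.** (1) $\Lambda$ is $1$-Gorenstein: it is a finite-dimensional algebra, and the injective dimensions of ${}_\Lambda\Lambda$ and of $\Lambda_\Lambda$ are at most $1$. Both are equal to $1$ if $Q$ has at least one arrow. (2) $H$ sends finitely generated $\Lambda$-modules to finitely generated $kQ$-modules, and the functor $H:\mathcal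 L\to\operatorname{mod}kQ$ is full. (3) $H$ induces a bijection from the set of isomorphism classes of indecomposable $\Lambda$-modules in $\mathcal L\setminus\mathcal P$ to the set of isomorphism classes of indecomposable finitely generated $kQ$-modules. (4) Every finitely generated $kQ$-module $N$ has a minimal right $\mathcal L$-approximation $\eta N\to N$, and $N\mapsto\eta N$ is the inverse of the bijection in (3): if $N$ is indecomposable, then for every minimal right $\mathcal L$-approximation $X\to N$ the module $X$ is indecomposable, lies in $\mathcal L\setminus\mathcal P$, and $H(X)\cong N$; and if $M\in\mathcal L\setminus\mathcal P$ is indecomposable, then $X\cong M$ for every minimal right $\mathcal L$-approximation $X\to H(M)$. (5) Every finitely generated $kQ$-module $N$ has a projective cover $p:P_0N\to N$ over $kQ$. Let $\Omega_0N=\operatorname{Ker}p$, let $(\Omega_0N)[\epsilon]$ be $\Omega_0N\oplus\Omega_0N$ with $\epsilon(x,y)=(y,0)$, and let $X$ be the pushout, in the category of $\Lambda$-modules, of the inclusion $\Omega_0N\to P_0N$ and the embedding $\Omega_0N\to(\Omega_0N)[\epsilon]$, $x\mapsto(x,0)$. Then the map $X\to N$ which is $p$ on $P_0N$ and $0$ on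 $(\Omega_0N)[\epsilon]$ is a minimal right $\mathcal L$-approximation of $N$. -/

import Mathlib

open CategoryTheory DualNumber

universe u v w

noncomputable section

/-! ### Path algebras -/

/-- A quiver is acyclic (also called directed) if every closed path is trivial. -/
def QuiverAcyclic (V : Type v) [Quiver.{w} V] : Prop :=
  ∀ (a : V) (p : Quiver.Path a a), p = Quiver.Path.nil

/-- The path algebra `kV`: the `k`-vector space with basis all paths of the quiver `V`.  A path is
a triple (source, target, path from source to target). -/
def PathAlgebra (k : Type u) [Field k] (V : Type v) [Quiver.{w} V] : Type (max u v w) :=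
  (Σ a b : V, Quiver.Path a b) →₀ k

namespace PathAlgebra

variable (k : Type u) [Field k] (V : Type v) [Quiver.{w} V]

instance : AddCommGroup (PathAlgebra k V) :=
  inferInstanceAs (AddCommGroup ((Σ a b : V, Quiver.Path a b) →₀ k))

instance : Module k (PathAlgebra k V) :=
  inferInstanceAs (Module k ((Σ a b : V, Quiver.Path a b) →₀ k))

variable {k V}

/-- The basis element given by a path. -/
def ofPath {a b : V} (p : Quiver.Path a b) : PathAlgebra k V :=
  Finsupp.single (⟨a, b, p⟩ : Σ a b : V, Quiver.Path a b) (1 : k)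

open Classical in
/-- The product `p * q` of two paths: it is `q` followed by `p` if `q` ends where `p` starts, and
`0` otherwise.  Thus left modules over the path algebra are representations of the quiver. -/
def pathMul (p q : Σ a b : V, Quiver.Path a b) : PathAlgebra k V :=
  if h : q.2.1 = p.1 then ofPath (q.2.2.comp (p.2.2.cast h.symm rfl)) else 0

variable (k V) in
/-- The multiplication of the path algebra, extended bilinearly from paths. -/
def mulLin : PathAlgebra k V →ₗ[k] PathAlgebra k V →ₗ[k] PathAlgebra k V :=
  Finsupp.linearCombination k fun p => Finsupp.linearCombination k (pathMul p)

instance : Mul (PathAlgebra k V) := ⟨fun x y => mulLin k V x y⟩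

/-- The unit is the sum of the trivial paths. -/
instance [Fintype V] : One (PathAlgebra k V) := ⟨∑ a : V, ofPath (Quiver.Path.nil : Quiver.Path a a)⟩

theorem mul_def (x y : PathAlgebra k V) : x * y = mulLin k V x y := rfl

theorem one_def [Fintype V] :
    (1 : PathAlgebra k V) = ∑ a : V, ofPath (Quiver.Path.nil : Quiver.Path a a) := rfl

theorem mulLin_ofPath {a b c d : V} (p : Quiver.Path a b) (q : Quiver.Path c d) :
    mulLin k V (ofPath p) (ofPath q) = pathMul ⟨a, b, p⟩ ⟨c, d, q⟩ := by
  simp only [mulLin, ofPath]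
  erw [Finsupp.linearCombination_single, one_smul]
  erw [Finsupp.linearCombination_single, one_smul]

theorem ofPath_mul_ofPath {a b c : V} (p : Quiver.Path b c) (q : Quiver.Path a b) :
    (ofPath p * ofPath q : PathAlgebra k V) = ofPath (q.comp p) := by
  rw [mul_def, mulLin_ofPath]
  simp [pathMul]

theorem ofPath_mul_ofPath_of_ne {a b c d : V} (p : Quiver.Path c d) (q : Quiver.Path a b)
    (h : b ≠ c) : (ofPath p * ofPath q : PathAlgebra k V) = 0 := by
  rw [mul_def, mulLin_ofPath]
  simp [pathMul, h]

theorem induction_on {P : PathAlgebra k V → Prop} (x : PathAlgebra k V) (h0 : P 0)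
    (hadd : ∀ x y, P x → P y → P (x + y))
    (hp : ∀ (c : k) {a b : V} (p : Quiver.Path a b), P (c • ofPath p)) : P x := by
  refine Finsupp.induction_linear (motive := P) x h0 hadd ?_
  rintro ⟨a, b, p⟩ c
  have := hp c p
  have e : (c • ofPath p : PathAlgebra k V) =
      (Finsupp.single ⟨a, b, p⟩ c : (Σ a b : V, Quiver.Path a b) →₀ k) :=
    (Finsupp.smul_single c _ (1 : k)).trans (by simp)
  exact e ▸ this

theorem add_mul' (x y z : PathAlgebra k V) : (x + y) * z = x * z + y * z := by
  simp [mul_def]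

theorem mul_add' (x y z : PathAlgebra k V) : x * (y + z) = x * y + x * z := by
  simp [mul_def]

theorem smul_mul' (c : k) (x y : PathAlgebra k V) : (c • x) * y = c • (x * y) := by
  simp [mul_def]

theorem mul_smul' (c : k) (x y : PathAlgebra k V) : x * (c • y) = c • (x * y) := by
  simp [mul_def]

theorem zero_mul' (x : PathAlgebra k V) : 0 * x = 0 := by simp [mul_def]

theorem mul_zero' (x : PathAlgebra k V) : x * 0 = 0 := by simp [mul_def]

theorem mul_assoc' (x y z : PathAlgebra k V) : x * y * z = x * (y * z) := by
  induction x using induction_on with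
  | h0 => simp only [zero_mul']
  | hadd x x' hx hx' => simp only [add_mul', hx, hx']
  | hp c p =>
    induction y using induction_on with
    | h0 => simp only [zero_mul', mul_zero']
    | hadd y y' hy hy' => simp only [add_mul', mul_add', hy, hy']
    | hp c' q =>
      induction z using induction_on with
      | h0 => simp only [mul_zero']
      | hadd z z' hz hz' => simp only [mul_add', hz, hz']
      | hp c'' r =>
        simp only [smul_mul', mul_smul']
        congr 3
        rename_i a b a' b' a'' b''
        by_cases h : b' = a
        · subst h
          rw [ofPath_mul_ofPath]
          by_cases h' : b'' = a'
          · subst h'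
            rw [ofPath_mul_ofPath, ofPath_mul_ofPath, ofPath_mul_ofPath, Quiver.Path.comp_assoc]
          · rw [ofPath_mul_ofPath_of_ne _ _ h', ofPath_mul_ofPath_of_ne _ _ h', mul_zero']
        · rw [ofPath_mul_ofPath_of_ne _ _ h, zero_mul']
          by_cases h' : b'' = a'
          · subst h'
            rw [ofPath_mul_ofPath, ofPath_mul_ofPath_of_ne _ _ h]
          · rw [ofPath_mul_ofPath_of_ne _ _ h', mul_zero']

theorem one_mul' [Fintype V] (x : PathAlgebra k V) : 1 * x = x := by
  induction x using induction_on with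
  | h0 => exact mul_zero' _
  | hadd x y hx hy => rw [mul_add', hx, hy]
  | hp c p =>
    rename_i a b
    rw [mul_smul', one_def, mul_def, map_sum, LinearMap.sum_apply, Finset.sum_eq_single b]
    · rw [← mul_def, ofPath_mul_ofPath]; rfl
    · intro d _ hd
      rw [← mul_def, ofPath_mul_ofPath_of_ne _ _ hd.symm]
    · simp

theorem mul_one' [Fintype V] (x : PathAlgebra k V) : x * 1 = x := by
  induction x using induction_on with
  | h0 => exact zero_mul' _
  | hadd x y hx hy => rw [add_mul', hx, hy]
  | hp c p =>
    rename_i a b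
    rw [smul_mul', one_def, mul_def, map_sum, Finset.sum_eq_single a]
    · rw [← mul_def, ofPath_mul_ofPath, Quiver.Path.nil_comp]
    · intro d _ hd
      rw [← mul_def, ofPath_mul_ofPath_of_ne _ _ hd]
    · simp

instance [Fintype V] : Ring (PathAlgebra k V) :=
  { (inferInstance : AddCommGroup (PathAlgebra k V)) with
    left_distrib := mul_add'
    right_distrib := add_mul'
    zero_mul := zero_mul'
    mul_zero := mul_zero'
    mul_assoc := mul_assoc'
    one_mul := one_mul'
    mul_one := mul_one' }

instance [Fintype V] : Algebra k (PathAlgebra k V) :=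
  Algebra.ofModule smul_mul' mul_smul'

end PathAlgebra

/-! ### Gorenstein algebras of dimension at most one, and torsionless modules -/

/-- A finite-dimensional `k`-algebra `R` is `1`-Gorenstein if `R` has injective dimension at most
`1` both as a left module and as a right module over itself. -/
structure IsOneGorenstein (k : Type u) [Field k] (R : Type v) [Ring R] [Algebra k R] : Prop where
  finite : Module.Finite k R
  left : HasInjectiveDimensionLE (ModuleCat.of.{v} R R) 1
  right : HasInjectiveDimensionLE (ModuleCat.of.{v} Rᵐᵒᵖ R) 1

/-- The finitely generated modules. -/
def fgModules (R : Type u) [Ring R] : ObjectProperty (ModuleCat.{u} R) :=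
  fun M => Module.Finite R M

/-- The finitely generated torsionless modules: those which embed into a projective module. -/
def torsionless (R : Type u) [Ring R] : ObjectProperty (ModuleCat.{u} R) :=
  fun M => Module.Finite R M ∧
    ∃ (P : ModuleCat.{u} R) (f : M →ₗ[R] P), Module.Projective R P ∧ Function.Injective f

/-- The indecomposable finitely generated modules. -/
def indecFG (R : Type u) [Ring R] : ObjectProperty (ModuleCat.{u} R) :=
  fun N => fgModules R N ∧ Indecomposable N

/-- The indecomposable finitely generated torsionless modules which are not projective. -/
def indecTorsionlessNonproj (R : Type u) [Ring R] : ObjectProperty (ModuleCat.{u} R) :=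
  fun M => torsionless R M ∧ ¬ Module.Projective R M ∧ Indecomposable M

/-! ### Approximations and isomorphism classes -/

section Categories

variable {C : Type u} [Category.{v} C]

/-- `g : X ⟶ M` is a minimal right approximation of `M` by objects with property `L`: the object
`X` has property `L`, every map to `M` from an object with property `L` factors through `g`, and
`g` is right minimal, that is, every endomorphism `φ` of `X` with `g φ = g` is invertible. -/
structure IsMinimalRightApprox (L : ObjectProperty C) {X M : C} (g : X ⟶ M) : Prop where
  mem : L X
  factors : ∀ ⦃Y : C⦄, L Y → ∀ h : Y ⟶ M, ∃ h' : Y ⟶ X, h' ≫ g = h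
  minimal : ∀ φ : X ⟶ X, φ ≫ g = g → IsIso φ

/-- The isomorphism classes of a category. -/
abbrev IsoClass (C : Type u) [Category.{v} C] : Type u := Quotient (isIsomorphicSetoid C)

/-- The isomorphism classes of the objects with property `L`. -/
def isoClasses (L : ObjectProperty C) : Set (IsoClass C) :=
  {x | ∃ X : C, L X ∧ Quotient.mk (isIsomorphicSetoid C) X = x}

/-- The map induced by a functor on isomorphism classes. -/
def mapIsoClass {D : Type w} [Category.{v} D] (F : C ⥤ D) : IsoClass C → IsoClass D :=
  Quotient.map F.obj fun _ _ ⟨e⟩ => ⟨F.mapIso e⟩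

end Categories

/-- `p : P → N` is a projective cover of a finitely generated module: `P` is finitely generated
projective, and `p` is surjective with superfluous kernel. -/
structure IsProjCover {R : Type u} [Ring R] {P N : ModuleCat.{u} R} (p : P ⟶ N) : Prop where
  finite : Module.Finite R P
  projective : Module.Projective R P
  surjective : Function.Surjective p.hom
  superfluous : ∀ U : Submodule R P, U ⊔ LinearMap.ker p.hom = ⊤ → U = ⊤

/-! ### Modules over `R[ε]`, that is, differential `R`-modules -/

section Differential

variable (R : Type u) [Ring R]

/-- The ring homomorphism `R → R[ε]`, `a ↦ a`. -/
def dualInl : R →+* R[ε] := TrivSqZeroExt.inlHom R R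

/-- The ring homomorphism `R[ε] → R`, `a + b ε ↦ a`. -/
def dualFst : R[ε] →+* R := (TrivSqZeroExt.fstHom ℤ R R).toRingHom

/-- An `R`-module considered as an `R[ε]`-module annihilated by `ε`. -/
def trivialDiff : ModuleCat.{v} R ⥤ ModuleCat.{v} R[ε] :=
  ModuleCat.restrictScalars (dualFst R)

/-- The `R`-module underlying an `R[ε]`-module. -/
def underlying : ModuleCat.{v} R[ε] ⥤ ModuleCat.{v} R :=
  ModuleCat.restrictScalars (dualInl R)

variable {R}

/-- The differential of an `R[ε]`-module: multiplication by `ε`. -/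
def differential (M : ModuleCat.{v} R[ε]) :
    (underlying R).obj M →ₗ[R] (underlying R).obj M where
  toFun := fun x : M => (ε : R[ε]) • x
  map_add' := fun x y : M => smul_add (ε : R[ε]) x y
  map_smul' := fun (r : R) (x : M) => by
    change (ε : R[ε]) • (dualInl R r • x) = dualInl R r • ((ε : R[ε]) • x)
    rw [← mul_smul, ← mul_smul]
    congr 1
    ext <;> simp [dualInl]

/-- The kernel of the differential. -/
abbrev cycles (M : ModuleCat.{v} R[ε]) : Submodule R ((underlying R).obj M) :=
  LinearMap.ker (differential M)

/-- The image of the differential, inside its kernel. -/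
abbrev boundaries (M : ModuleCat.{v} R[ε]) : Submodule R (cycles M) :=
  (LinearMap.range (differential M)).submoduleOf (cycles M)

theorem differential_naturality {M M' : ModuleCat.{v} R[ε]} (f : M ⟶ M')
    (x : (underlying R).obj M) :
    ((underlying R).map f).hom (differential M x) =
      differential M' (((underlying R).map f).hom x) :=
  map_smul f.hom (ε : R[ε]) (show M from x)

/-- The map induced on cycles. -/
def cyclesMap {M M' : ModuleCat.{v} R[ε]} (f : M ⟶ M') : cycles M →ₗ[R] cycles M' :=
  ((underlying R).map f).hom.restrict fun x hx => by
    rw [LinearMap.mem_ker] at hx ⊢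
    rw [← differential_naturality, hx, map_zero]

theorem boundaries_le {M M' : ModuleCat.{v} R[ε]} (f : M ⟶ M') :
    boundaries M ≤ (boundaries M').comap (cyclesMap f) := by
  rintro ⟨x, hx⟩ ⟨y, hy⟩
  exact ⟨((underlying R).map f).hom y, by
    rw [← differential_naturality, hy]; rfl⟩

variable (R) in
/-- The homology functor: it sends an `R[ε]`-module `M` to the `R`-module `Ker ε / Im ε`. -/
def homology : ModuleCat.{v} R[ε] ⥤ ModuleCat.{v} R where
  obj M := ModuleCat.of R (cycles M ⧸ boundaries M)
  map f := ModuleCat.ofHom (Submodule.mapQ _ _ (cyclesMap f) (boundaries_le f))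
  map_id M := by
    ext x
    rfl
  map_comp f g := by
    ext x
    rfl

/-- The underlying group `N ⊕ N` of `N[ε]`. -/
structure DualMod (N : Type v) where
  fst : N
  snd : N

namespace DualMod

variable {N : Type v} [AddCommGroup N] [Module R N]

/-- `N[ε]` is identified with `N × N`. -/
def equivProd (N : Type v) : DualMod N ≃ N × N where
  toFun x := (x.fst, x.snd)
  invFun x := ⟨x.1, x.2⟩

instance : AddCommGroup (DualMod N) := (equivProd N).addCommGroup

/-- The action of `R[ε]` on `N[ε] = N ⊕ N`, for which `ε (x, y) = (y, 0)`. -/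
instance : SMul R[ε] (DualMod N) :=
  ⟨fun r x => ⟨r.fst • x.fst + r.snd • x.snd, r.fst • x.snd⟩⟩

@[ext]
theorem ext' {N : Type v} {x y : DualMod N} (h : x.fst = y.fst) (h' : x.snd = y.snd) : x = y := by
  cases x; cases y; simp_all

@[simp] theorem fst_add (x y : DualMod N) : (x + y).fst = x.fst + y.fst := rfl
@[simp] theorem snd_add (x y : DualMod N) : (x + y).snd = x.snd + y.snd := rfl
@[simp] theorem fst_zero : (0 : DualMod N).fst = 0 := rfl
@[simp] theorem snd_zero : (0 : DualMod N).snd = 0 := rfl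
@[simp] theorem fst_smul (r : R[ε]) (x : DualMod N) :
    (r • x).fst = r.fst • x.fst + r.snd • x.snd := rfl
@[simp] theorem snd_smul (r : R[ε]) (x : DualMod N) : (r • x).snd = r.fst • x.snd := rfl

instance : Module R[ε] (DualMod N) where
  one_smul x := by ext <;> simp
  mul_smul r s x := by ext <;> simp [mul_smul, add_smul, add_assoc]
  smul_zero r := by ext <;> simp
  zero_smul x := by ext <;> simp
  smul_add r x y := by
    ext
    · simp only [fst_smul, fst_add, snd_add, smul_add]; abel
    · simp
  add_smul r s x := by ext <;> simp [add_smul] ; abel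

end DualMod

/-- The `R[ε]`-module `N[ε]`. -/
def dualMod (N : ModuleCat.{v} R) : ModuleCat.{v} R[ε] := ModuleCat.of R[ε] (DualMod N)

/-- The embedding `N → N[ε]`, `x ↦ (x, 0)`, whose image is the kernel of `ε`. -/
def toDualMod (N : ModuleCat.{v} R) : (trivialDiff R).obj N ⟶ dualMod N :=
  ModuleCat.ofHom (X := (trivialDiff R).obj N) (Y := DualMod N)
    { toFun := fun x : N => (⟨x, 0⟩ : DualMod N)
      map_add' := fun x y : N => by
        apply DualMod.ext'
        · rfl
        · simp
      map_smul' := fun (r : R[ε]) (x : N) => by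
        change (⟨r.fst • x, 0⟩ : DualMod N) = r • (⟨x, 0⟩ : DualMod N)
        ext <;> simp }

end Differential

end

/-!
Apart from the lower bound on the injective dimensions, the argument only uses that `R = kV` is a
finite-dimensional algebra which is hereditary on both sides.

*Heredity.*  In `(kV) e_a` a proper submodule consists of combinations of nontrivial paths starting
at `a`, because the quiver has no oriented cycle; these combinations form a finite product of modules
`(kV) e_b`, one for each arrow `a ⟶ b`.  So all submodules of `(kV) e_a` are projective, by induction
along the arrows (`PathAlgebra.submodulesProjective`).  The opposite of `kV[ε]` is `kV'[ε]` for
the opposite quiver `V'`, which takes care of right modules.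

*Gorenstein property.*  `N ↦ N[ε]` is exact, and it preserves injective and projective modules,
being both coinduction and induction from `R` to `R[ε]`.  So an injective resolution
`0 → R → I → I / R → 0` yields one of `R[ε]` of length one.  If `α : a ⟶ b` is an arrow, then
`x α ↦ x e_b` is a homomorphism on `R[ε] α` which does not extend to `R[ε]`, so that `R[ε]` is not
injective.

*Torsionless modules.*  By heredity, the `R`-module underlying a finitely generated torsionless
`R[ε]`-module `M` has only projective submodules (`torsionless.submodulesProjective`).  Hence `M`
splits over `R` into its cycles and a copy of its boundaries, and every map on homology lifts to `M`
(`exists_homology_map_eq`).  For the same reason `M` is projective if its homology vanishes.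

*Approximations.*  Let `p : P → N` be a projective cover with kernel `Ω`.  The pushout is
`P ⊕ Ω ⊆ P[ε]`, its homology is `N`, and a map `h : M → N` lifts to `x ↦ (a x, a (ε x))` where
`a : M → P` is an `R`-linear lift of `h`.  An endomorphism of `P ⊕ Ω` which is invertible on homology
is surjective on `P`, as `Ω` is superfluous, hence it is invertible (`isIso_of_isIso_homology_map`).
This gives minimality, and it makes `P ⊕ Ω` indecomposable when `N` is.  Conversely, by fullness, the
approximation of `H(M)` is a direct summand of every torsionless `M`, so it is `M` if `M` is
indecomposable and not projective (`nonempty_approxObj_iso`); and idempotents of `H(M)` lift to the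
endomorphism ring of `M`, which is local by the Fitting decomposition.
-/

noncomputable section

/-! ### Modules all of whose submodules are projective -/

/-- Every submodule of `M` is projective.  For `M = R` this says that `R` is left hereditary. -/
def SubmodulesProjective (R : Type*) [Ring R] (M : Type*) [AddCommGroup M] [Module R M] : Prop :=
  ∀ U : Submodule R M, Module.Projective R U

namespace SubmodulesProjective

variable {R : Type*} [Ring R] {M N : Type*} [AddCommGroup M] [Module R M] [AddCommGroup N]
  [Module R N]

theorem of_injective (h : SubmodulesProjective R N) (f : M →ₗ[R] N) (hf : Function.Injective f) :
    SubmodulesProjective R M := fun U =>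
  have := h (U.map f)
  Module.Projective.of_equiv (Submodule.equivMapOfInjective f hf U).symm

theorem projective (h : SubmodulesProjective R M) : Module.Projective R M :=
  have := h ⊤
  Module.Projective.of_equiv (Submodule.topEquiv (R := R) (M := M))

/-- If the kernel and the image of `f` are projective, then `M` is their direct sum. -/
theorem projective_of_ker (h : SubmodulesProjective R N) (f : M →ₗ[R] N) (hM : SubmodulesProjective R f.ker) :
    Module.Projective R M := by
  have := h f.range
  have := hM.projective
  obtain ⟨s, hs⟩ := Module.projective_lifting_property f.rangeRestrict LinearMap.id
    f.surjective_rangeRestrict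
  have hs' : ∀ y, f (s y) = y := fun y => congrArg Subtype.val (LinearMap.congr_fun hs y)
  refine Module.Projective.of_split (M := f.ker × f.range)
    (((LinearMap.id - s ∘ₗ f.rangeRestrict).codRestrict f.ker fun x => ?_).prod f.rangeRestrict)
    (LinearMap.coprod f.ker.subtype s) ?_
  · ext x
    simp
  · change f (x - s (f.rangeRestrict x)) = 0
    simp [hs']

/-- The projection of a submodule of `M × N` to `N` splits. -/
theorem prod (hM : SubmodulesProjective R M) (hN : SubmodulesProjective R N) :
    SubmodulesProjective R (M × N) := fun U => by
  refine projective_of_ker hN (LinearMap.snd R M N ∘ₗ U.subtype)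
    (hM.of_injective ((LinearMap.fst R M N ∘ₗ U.subtype) ∘ₗ Submodule.subtype _) ?_)
  rintro ⟨⟨⟨x, y⟩, hx⟩, hy⟩ ⟨⟨⟨x', y'⟩, hx'⟩, hy'⟩ h
  simp only [LinearMap.mem_ker, LinearMap.coe_comp, Submodule.coe_subtype, Function.comp_apply,
    LinearMap.snd_apply] at hy hy'
  simp_all

theorem pi_fin {n : ℕ} {M : Fin n → Type*} [∀ i, AddCommGroup (M i)] [∀ i, Module R (M i)]
    (h : ∀ i, SubmodulesProjective R (M i)) : SubmodulesProjective R (∀ i, M i) := by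
  induction n with
  | zero => exact fun U => inferInstance
  | succ n ih =>
    exact ((h 0).prod (ih fun i => h i.succ)).of_injective
      (Fin.consLinearEquiv R M).symm.toLinearMap (Fin.consLinearEquiv R M).symm.injective

theorem pi {ι : Type*} [Finite ι] {M : ι → Type*} [∀ i, AddCommGroup (M i)]
    [∀ i, Module R (M i)] (h : ∀ i, SubmodulesProjective R (M i)) :
    SubmodulesProjective R (∀ i, M i) := by
  obtain ⟨n, ⟨e⟩⟩ := Finite.exists_equiv_fin ι
  exact (pi_fin fun i => h (e.symm i)).of_injective
    (LinearEquiv.piCongrLeft' R M e).toLinearMap (LinearEquiv.piCongrLeft' R M e).injective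

end SubmodulesProjective

/-! ### Paths in a finite acyclic quiver -/

section Paths

variable {V : Type v} [Quiver.{w} V]

theorem Quiver.Path.exists_eq_toPath_comp {a c : V} (p : Quiver.Path a c) :
    (∃ h : a = c, p = Quiver.Path.nil.cast rfl h) ∨
      ∃ (b : V) (α : a ⟶ b) (q : Quiver.Path b c), p = α.toPath.comp q := by
  induction p with
  | nil => exact .inl ⟨rfl, rfl⟩
  | cons p e ih =>
    obtain ⟨rfl, rfl⟩ | ⟨b, α, q, rfl⟩ := ih
    · exact .inr ⟨_, e, .nil, rfl⟩
    · exact .inr ⟨b, α, q.cons e, rfl⟩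

/-- A nontrivial path determines its first arrow and the remaining path. -/
theorem Quiver.Path.toPath_comp_inj {a b b' c : V} {α : a ⟶ b} {β : a ⟶ b'} {p : Quiver.Path b c}
    {q : Quiver.Path b' c} (h : α.toPath.comp p = β.toPath.comp q) :
    (⟨b, α, p⟩ : Σ b, (a ⟶ b) × Quiver.Path b c) = ⟨b', β, q⟩ := by
  induction p with
  | nil =>
    cases q with
    | nil => cases h; rfl
    | cons q f =>
      have := congrArg Quiver.Path.length h
      simp [Quiver.Path.length_comp] at this
  | cons p e ih =>
    cases q with
    | nil =>
      have := congrArg Quiver.Path.length h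
      simp [Quiver.Path.length_comp] at this
    | cons q f =>
      simp only [Quiver.Path.comp_cons, Quiver.Path.cons.injEq] at h
      obtain ⟨rfl, h, h'⟩ := h
      cases h'
      cases ih (eq_of_heq h)
      rfl

/-- In a finite acyclic quiver, the relation given by the arrows is well-founded. -/
theorem QuiverAcyclic.wellFounded [Finite V] (hV : QuiverAcyclic V) :
    WellFounded fun b a : V => Nonempty (a ⟶ b) := by
  have key : ∀ a b : V, Relation.TransGen (fun b a : V => Nonempty (a ⟶ b)) b a →
      ∃ p : Quiver.Path a b, p.length ≠ 0 := by
    intro a b h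
    induction h with
    | single h => exact ⟨h.some.toPath, by simp⟩
    | tail _ h ih =>
      obtain ⟨p, hp⟩ := ih
      exact ⟨h.some.toPath.comp p, by simp [Quiver.Path.length_comp]⟩
  have : Std.Irrefl (Relation.TransGen (fun b a : V => Nonempty (a ⟶ b))) := ⟨fun a h => by
    obtain ⟨p, hp⟩ := key a a h
    rw [hV a p] at hp
    exact hp rfl⟩
  exact (Finite.wellFounded_of_trans_of_irrefl
    (Relation.TransGen (fun b a : V => Nonempty (a ⟶ b)))).mono fun _ _ h => .single h

theorem QuiverAcyclic.finite_paths [Finite V] [∀ a b : V, Finite (a ⟶ b)] (hV : QuiverAcyclic V) :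
    Finite (Σ a b : V, Quiver.Path a b) := by
  have key : ∀ a : V, Finite (Σ b : V, Quiver.Path a b) := fun a => by
    induction a using hV.wellFounded.induction with
    | _ a ih =>
      have : ∀ α : (Σ b : V, a ⟶ b), Finite (Σ c : V, Quiver.Path α.1 c) := fun α => ih _ ⟨α.2⟩
      refine Finite.of_surjective (fun x : Option (Σ α : (Σ b : V, a ⟶ b),
        Σ c : V, Quiver.Path α.1 c) => match x with
        | none => (⟨a, .nil⟩ : Σ b : V, Quiver.Path a b)
        | some ⟨α, c, p⟩ => ⟨c, α.2.toPath.comp p⟩) ?_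
      rintro ⟨c, p⟩
      obtain ⟨rfl, rfl⟩ | ⟨b, α, q, rfl⟩ := p.exists_eq_toPath_comp
      · exact ⟨none, rfl⟩
      · exact ⟨some ⟨⟨b, α⟩, c, q⟩, rfl⟩
  infer_instance

end Paths

/-! ### The path algebra is hereditary -/

namespace PathAlgebra

variable {k : Type u} [Field k] {V : Type v} [Quiver.{w} V]

/-- The coefficient of a path in an element of the path algebra. -/
def coeff (p : Σ a b : V, Quiver.Path a b) : PathAlgebra k V →ₗ[k] k :=
  Finsupp.lapply p

theorem ext_coeff {x y : PathAlgebra k V} (h : ∀ p, coeff p x = coeff p y) : x = y :=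
  Finsupp.ext h

open Classical in
theorem coeff_ofPath (p : Σ a b : V, Quiver.Path a b) {a b : V} (q : Quiver.Path a b) :
    coeff p (ofPath q : PathAlgebra k V) = if ⟨a, b, q⟩ = p then 1 else 0 :=
  Finsupp.single_apply

theorem coeff_ofPath_self {a b : V} (q : Quiver.Path a b) :
    coeff ⟨a, b, q⟩ (ofPath q : PathAlgebra k V) = 1 := by
  rw [coeff_ofPath, if_pos rfl]

theorem coeff_ofPath_of_ne {p : Σ a b : V, Quiver.Path a b} {a b : V} {q : Quiver.Path a b}
    (h : ⟨a, b, q⟩ ≠ p) : coeff p (ofPath q : PathAlgebra k V) = 0 := by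
  rw [coeff_ofPath, if_neg h]

theorem finite_of_acyclic [Finite V] [∀ a b : V, Finite (a ⟶ b)] (hV : QuiverAcyclic V) :
    Module.Finite k (PathAlgebra k V) :=
  have := hV.finite_paths
  inferInstanceAs (Module.Finite k ((Σ a b : V, Quiver.Path a b) →₀ k))

/-- The idempotent of a vertex. -/
abbrev idem (k : Type u) [Field k] (a : V) : PathAlgebra k V :=
  ofPath (Quiver.Path.nil : Quiver.Path a a)

theorem idem_mul_idem (a : V) : idem k a * idem k a = idem k a := ofPath_mul_ofPath _ _

/-- Right multiplication by an arrow `α` shifts coefficients. -/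
theorem coeff_mul_toPath {a b c : V} (α : a ⟶ b) (p : Quiver.Path b c) (x : PathAlgebra k V) :
    coeff ⟨a, c, α.toPath.comp p⟩ (x * ofPath α.toPath) = coeff ⟨b, c, p⟩ x := by
  induction x using induction_on with
  | h0 => rw [zero_mul', map_zero, map_zero]
  | hadd x y hx hy => rw [add_mul', map_add, map_add, hx, hy]
  | hp r q =>
    rename_i b' c'
    rw [smul_mul', map_smul, map_smul]
    congr 1
    by_cases hb : b = b'
    · subst hb
      rw [ofPath_mul_ofPath]
      by_cases h : (⟨b, c', q⟩ : Σ a b : V, Quiver.Path a b) = ⟨b, c, p⟩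
      · cases h
        rw [coeff_ofPath_self, coeff_ofPath_self]
      · rw [coeff_ofPath_of_ne h, coeff_ofPath_of_ne]
        intro h'
        simp only [Sigma.mk.injEq, heq_eq_eq, true_and] at h'
        obtain ⟨rfl, h'⟩ := h'
        cases Quiver.Path.toPath_comp_inj (eq_of_heq h')
        exact h rfl
    · rw [ofPath_mul_ofPath_of_ne _ _ hb, map_zero, coeff_ofPath_of_ne]
      rintro h
      cases h
      exact hb rfl

theorem coeff_mul_toPath_of_ne {a b c a' b' : V} (α : a ⟶ b) (β : a' ⟶ b') (p : Quiver.Path b c)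
    (x : PathAlgebra k V) (h : (⟨a, b, α⟩ : Σ a b : V, (a ⟶ b)) ≠ ⟨a', b', β⟩) :
    coeff ⟨a, c, α.toPath.comp p⟩ (x * ofPath β.toPath) = 0 := by
  induction x using induction_on with
  | h0 => rw [zero_mul', map_zero]
  | hadd x y hx hy => rw [add_mul', map_add, hx, hy, add_zero]
  | hp r q =>
    rename_i d c'
    rw [smul_mul', map_smul]
    by_cases hb : b' = d
    · subst hb
      rw [ofPath_mul_ofPath, coeff_ofPath_of_ne, smul_zero]
      intro h'
      simp only [Sigma.mk.injEq] at h'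
      obtain ⟨rfl, h'⟩ := h'
      simp only [heq_eq_eq, Sigma.mk.injEq] at h'
      obtain ⟨rfl, h'⟩ := h'
      cases Quiver.Path.toPath_comp_inj (eq_of_heq h')
      exact h rfl
    · rw [ofPath_mul_ofPath_of_ne _ _ hb, map_zero, smul_zero]

variable [Fintype V]

/-- The left ideal `(kV) e_a` spanned by the paths which start at `a`. -/
def startingAt (k : Type u) [Field k] (a : V) : Submodule (PathAlgebra k V) (PathAlgebra k V) :=
  LinearMap.eqLocus (LinearMap.toSpanSingleton _ _ (idem k a)) LinearMap.id

theorem mem_startingAt {a : V} {x : PathAlgebra k V} : x ∈ startingAt k a ↔ x * idem k a = x :=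
  Iff.rfl

theorem projective_startingAt (a : V) : Module.Projective (PathAlgebra k V) (startingAt k a) :=
  Module.Projective.of_split (M := PathAlgebra k V) (startingAt k a).subtype
    ((LinearMap.toSpanSingleton _ _ (idem k a)).codRestrict _ fun x => by
      rw [mem_startingAt, LinearMap.toSpanSingleton_apply, smul_eq_mul, mul_assoc, idem_mul_idem])
    (by
      ext x
      exact x.2)

/-- The map which sends a family `(x_α)`, indexed by the arrows `α : a ⟶ b` which start at `a`,
of elements `x_α` of `(kV) e_b` to `∑ x_α α`.  Its image is the radical of `(kV) e_a`. -/
def sumMulArrow (k : Type u) [Field k] (a : V) [Fintype (Σ b, a ⟶ b)] :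
    (∀ α : Σ b : V, a ⟶ b, startingAt k α.1) →ₗ[PathAlgebra k V] PathAlgebra k V :=
  ∑ α : Σ b : V, a ⟶ b, LinearMap.toSpanSingleton _ _ (ofPath α.2.toPath) ∘ₗ
    (startingAt k α.1).subtype ∘ₗ LinearMap.proj α

theorem sumMulArrow_apply (a : V) [Fintype (Σ b, a ⟶ b)]
    (x : ∀ α : Σ b : V, a ⟶ b, startingAt k α.1) :
    sumMulArrow k a x = ∑ α, (x α : PathAlgebra k V) * ofPath α.2.toPath := by
  simp [sumMulArrow]

/-- Elements of `(kV) e_a` involve only paths which start at `a`. -/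
theorem coeff_mul_idem {a b c : V} (x : PathAlgebra k V) (p : Quiver.Path b c) (h : a ≠ b) :
    coeff ⟨b, c, p⟩ (x * idem k a) = 0 := by
  induction x using induction_on with
  | h0 => rw [zero_mul', map_zero]
  | hadd x y hx hy => rw [add_mul', map_add, hx, hy, add_zero]
  | hp r q =>
    rename_i d c'
    rw [smul_mul', map_smul]
    by_cases hb : a = d
    · subst hb
      rw [ofPath_mul_ofPath, coeff_ofPath_of_ne, smul_zero]
      rintro h'
      cases h'
      exact h rfl
    · rw [ofPath_mul_ofPath_of_ne _ _ hb, map_zero, smul_zero]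

theorem sumMulArrow_injective (a : V) [Fintype (Σ b, a ⟶ b)] :
    Function.Injective (sumMulArrow k a) := by
  rw [← LinearMap.ker_eq_bot, LinearMap.ker_eq_bot']
  intro x hx
  ext1 α
  apply Subtype.ext
  refine ext_coeff ?_
  rintro ⟨b, c, p⟩
  rw [Pi.zero_apply, Submodule.coe_zero, map_zero]
  by_cases hb : α.1 = b
  · obtain ⟨b', α⟩ := α
    subst hb
    have := congrArg (coeff ⟨a, c, α.toPath.comp p⟩) hx
    rw [sumMulArrow_apply, map_sum, Finset.sum_eq_single ⟨b', α⟩, coeff_mul_toPath, map_zero] at this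
    · exact this
    · intro β _ hβ
      apply coeff_mul_toPath_of_ne
      intro h
      cases h
      exact hβ rfl
    · simp
  · rw [← mem_startingAt.1 (x α).2, coeff_mul_idem _ _ hb]

/-- An element of `(kV) e_a` without a component at the trivial path is a combination of paths
which have a first arrow. -/
theorem mem_range_sumMulArrow {a : V} [Fintype (Σ b, a ⟶ b)] {x : PathAlgebra k V}
    (hx : x ∈ startingAt k a) (h : coeff ⟨a, a, .nil⟩ x = 0) :
    x ∈ LinearMap.range (sumMulArrow k a) := by
  have key : ∀ x : PathAlgebra k V, x * idem k a - coeff ⟨a, a, .nil⟩ x • idem k a ∈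
      LinearMap.range (sumMulArrow k a) := by
    intro x
    induction x using induction_on with
    | h0 => simp
    | hadd x y hx hy =>
      convert add_mem hx hy using 1
      rw [add_mul', map_add, add_smul]
      abel
    | hp r q =>
      rename_i d c
      rw [smul_mul', map_smul, smul_assoc, ← smul_sub]
      rw [← one_smul (PathAlgebra k V) (_ - _), ← smul_assoc]
      refine Submodule.smul_mem _ _ ?_
      by_cases hd : a = d
      · subst hd
        rw [ofPath_mul_ofPath, Quiver.Path.nil_comp]
        obtain ⟨rfl, rfl⟩ | ⟨b, α, q, rfl⟩ := q.exists_eq_toPath_comp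
        · rw [Quiver.Path.cast_rfl_rfl, coeff_ofPath_self, one_smul, sub_self]
          exact zero_mem _
        · rw [coeff_ofPath_of_ne, zero_smul, sub_zero]
          · classical
            refine ⟨Pi.single ⟨b, α⟩ ⟨ofPath q, ?_⟩, ?_⟩
            · rw [mem_startingAt, ofPath_mul_ofPath, Quiver.Path.nil_comp]
            · rw [sumMulArrow_apply, Finset.sum_eq_single ⟨b, α⟩]
              · rw [Pi.single_eq_same, ofPath_mul_ofPath]
              · intro β _ hβ
                rw [Pi.single_eq_of_ne hβ, Submodule.coe_zero, zero_mul]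
              · simp
          · intro h
            simp only [Sigma.mk.injEq, heq_eq_eq, true_and] at h
            obtain ⟨rfl, h⟩ := h
            have := congrArg Quiver.Path.length (eq_of_heq h)
            simp [Quiver.Path.length_comp] at this
      · rw [ofPath_mul_ofPath_of_ne _ _ hd, coeff_ofPath_of_ne, zero_smul, sub_zero]
        · exact zero_mem _
        · intro h
          cases h
          exact hd rfl
  have := key x
  rwa [h, zero_smul, sub_zero, mem_startingAt.1 hx] at this

/-- Since the quiver is acyclic, `e_a (kV) e_a` consists of the multiples of `e_a`. -/
theorem idem_mul_mul_idem (hV : QuiverAcyclic V) (a : V) (x : PathAlgebra k V) :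
    idem k a * (x * idem k a) = coeff ⟨a, a, .nil⟩ x • idem k a := by
  induction x using induction_on with
  | h0 => rw [zero_mul', mul_zero', map_zero, zero_smul]
  | hadd x y hx hy => rw [add_mul', mul_add', map_add, add_smul, hx, hy]
  | hp r q =>
    rename_i d c
    rw [smul_mul', mul_smul', map_smul, smul_assoc]
    congr 1
    by_cases hd : a = d
    · subst hd
      rw [ofPath_mul_ofPath, Quiver.Path.nil_comp]
      by_cases hc : c = a
      · subst hc
        rw [hV _ q, ofPath_mul_ofPath, coeff_ofPath_self, one_smul]
        rfl
      · rw [ofPath_mul_ofPath_of_ne _ _ hc, coeff_ofPath_of_ne, zero_smul]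
        intro h
        cases h
        exact hc rfl
    · rw [ofPath_mul_ofPath_of_ne _ _ hd, coeff_ofPath_of_ne, mul_zero', zero_smul]
      intro h
      cases h
      exact hd rfl

/-- A submodule of `(kV) e_a` is `(kV) e_a` or lies in the radical, which is isomorphic to a
finite product of modules `(kV) e_b` for arrows `a ⟶ b`. -/
theorem submodulesProjective_startingAt [∀ a b : V, Finite (a ⟶ b)] (hV : QuiverAcyclic V)
    (a : V) : SubmodulesProjective (PathAlgebra k V) (startingAt k a) := by
  induction a using hV.wellFounded.induction with
  | _ a ih =>
    intro U
    -- If `x ∈ U` involves the trivial path at `a`, then `e_a x` is a nonzero multiple of `e_a`.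
    by_cases hU : ∃ x ∈ U, coeff ⟨a, a, .nil⟩ (x : PathAlgebra k V) ≠ 0
    · obtain ⟨x, hx, hc⟩ := hU
      suffices U = ⊤ by
        subst this
        have := projective_startingAt (k := k) a
        exact Module.Projective.of_equiv Submodule.topEquiv.symm
      have he : idem k a ∈ startingAt k a := idem_mul_idem a
      have hU : (⟨idem k a, he⟩ : startingAt k a) ∈ U := by
        convert U.smul_mem ((coeff ⟨a, a, .nil⟩ (x : PathAlgebra k V))⁻¹ • idem k a) hx using 1
        apply Subtype.ext
        rw [Submodule.coe_smul, smul_eq_mul, smul_mul']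
        have hmul := idem_mul_mul_idem hV a (x : PathAlgebra k V)
        rw [mem_startingAt.1 x.2] at hmul
        rw [hmul, inv_smul_smul₀ hc]
      rw [eq_top_iff]
      rintro y -
      convert U.smul_mem (y : PathAlgebra k V) hU using 1
      exact Subtype.ext (mem_startingAt.1 y.2).symm
    · have : Fintype (Σ b, a ⟶ b) := Fintype.ofFinite _
      have h : SubmodulesProjective (PathAlgebra k V) (LinearMap.range (sumMulArrow k a)) :=
        (SubmodulesProjective.pi fun α : Σ b, a ⟶ b => ih _ ⟨α.2⟩).of_injective
          (LinearEquiv.ofInjective _ (sumMulArrow_injective a)).symm.toLinearMap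
          (LinearEquiv.ofInjective _ (sumMulArrow_injective a)).symm.injective
      refine (h.of_injective (((startingAt k a).subtype ∘ₗ U.subtype).codRestrict _ ?_) ?_).projective
      · intro x
        refine mem_range_sumMulArrow x.1.2 ?_
        by_contra h
        exact hU ⟨x.1, x.2, h⟩
      · intro x y h
        have h' := congrArg Subtype.val h
        exact Subtype.ext (Subtype.ext h')

/-- The path algebra embeds into the product of the modules `(kV) e_a`, hence it is left
hereditary. -/
theorem submodulesProjective [∀ a b : V, Finite (a ⟶ b)] (hV : QuiverAcyclic V) :
    SubmodulesProjective (PathAlgebra k V) (PathAlgebra k V) := by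
  refine (SubmodulesProjective.pi fun a : V => submodulesProjective_startingAt hV a).of_injective
    (LinearMap.pi fun a => (LinearMap.toSpanSingleton _ _ (idem k a)).codRestrict _ fun x => ?_) ?_
  · rw [mem_startingAt, LinearMap.toSpanSingleton_apply, smul_eq_mul, mul_assoc, idem_mul_idem]
  · intro x y h
    rw [← mul_one x, ← mul_one y, one_def, Finset.mul_sum, Finset.mul_sum]
    exact Finset.sum_congr rfl fun a _ => congrArg Subtype.val (congrFun h a)

end PathAlgebra

/-! ### The opposite of a path algebra -/

section Opposite

open Opposite

variable {V : Type v} [Quiver.{w} V]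

/-- The path of the opposite quiver obtained by reversing a path. -/
def Quiver.Path.toOp {a : V} : ∀ {b : V}, Quiver.Path a b → Quiver.Path (op b) (op a)
  | _, .nil => .nil
  | _, .cons p e => (Quiver.Hom.toPath e.op).comp p.toOp

/-- The path obtained by reversing a path of the opposite quiver. -/
def Quiver.Path.ofOp {x : Vᵒᵖ} : ∀ {y : Vᵒᵖ}, Quiver.Path x y → Quiver.Path y.unop x.unop
  | _, .nil => .nil
  | _, .cons p e => (Quiver.Hom.toPath e.unop).comp p.ofOp

theorem Quiver.Path.toOp_comp {a b c : V} (p : Quiver.Path a b) (q : Quiver.Path b c) :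
    (p.comp q).toOp = q.toOp.comp p.toOp := by
  induction q with
  | nil => rw [Quiver.Path.comp_nil]; exact (Quiver.Path.nil_comp _).symm
  | cons q e ih => rw [Quiver.Path.comp_cons, toOp, ih, toOp, Quiver.Path.comp_assoc]

theorem Quiver.Path.ofOp_comp {a b c : Vᵒᵖ} (p : Quiver.Path a b) (q : Quiver.Path b c) :
    (p.comp q).ofOp = q.ofOp.comp p.ofOp := by
  induction q with
  | nil => rw [Quiver.Path.comp_nil]; exact (Quiver.Path.nil_comp _).symm
  | cons q e ih => rw [Quiver.Path.comp_cons, ofOp, ih, ofOp, Quiver.Path.comp_assoc]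

theorem Quiver.Path.ofOp_toOp {a b : V} (p : Quiver.Path a b) : p.toOp.ofOp = p := by
  induction p with
  | nil => rfl
  | cons p e ih => rw [toOp, ofOp_comp, ih]; rfl

theorem Quiver.Path.toOp_ofOp {a b : Vᵒᵖ} (p : Quiver.Path a b) : p.ofOp.toOp = p := by
  induction p with
  | nil => rfl
  | cons p e ih => rw [ofOp, toOp_comp, ih]; rfl

theorem QuiverAcyclic.op (hV : QuiverAcyclic V) : QuiverAcyclic Vᵒᵖ := fun a p => by
  rw [← p.toOp_ofOp, hV _ p.ofOp]
  rfl

variable (V) in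
/-- The bijection between the paths of a quiver and those of the opposite quiver. -/
def pathsOpEquiv : (Σ a b : V, Quiver.Path a b) ≃ Σ a b : Vᵒᵖ, Quiver.Path a b where
  toFun p := ⟨_, _, p.2.2.toOp⟩
  invFun p := ⟨_, _, p.2.2.ofOp⟩
  left_inv p := by
    change (⟨p.1, p.2.1, p.2.2.toOp.ofOp⟩ : Σ a b : V, Quiver.Path a b) = p
    rw [Quiver.Path.ofOp_toOp]
  right_inv p := by
    change (⟨p.1, p.2.1, p.2.2.ofOp.toOp⟩ : Σ a b : Vᵒᵖ, Quiver.Path a b) = p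
    rw [Quiver.Path.toOp_ofOp]

namespace PathAlgebra

variable {k : Type u} [Field k]

/-- Reversing paths, as a linear map. -/
def opLinearEquiv (k : Type u) [Field k] (V : Type v) [Quiver.{w} V] : PathAlgebra k V ≃ₗ[k] PathAlgebra k Vᵒᵖ :=
  Finsupp.domLCongr (pathsOpEquiv V)

theorem opLinearEquiv_ofPath {a b : V} (p : Quiver.Path a b) :
    opLinearEquiv k V (ofPath p) = ofPath p.toOp :=
  Finsupp.domLCongr_single _ _ _

theorem opLinearEquiv_mul (x y : PathAlgebra k V) :
    opLinearEquiv k V (x * y) = opLinearEquiv k V y * opLinearEquiv k V x := by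
  induction x using induction_on with
  | h0 => rw [zero_mul', map_zero, mul_zero']
  | hadd x x' hx hx' => rw [add_mul', map_add, map_add, mul_add', hx, hx']
  | hp r p =>
    induction y using induction_on with
    | h0 => rw [mul_zero', map_zero, zero_mul']
    | hadd y y' hy hy' => rw [mul_add', map_add, map_add, add_mul', hy, hy']
    | hp s q =>
      rename_i a b c d
      simp only [smul_mul', mul_smul', map_smul]
      rw [smul_comm]
      congr 2
      by_cases h : d = a
      · subst h
        rw [ofPath_mul_ofPath, opLinearEquiv_ofPath, opLinearEquiv_ofPath, opLinearEquiv_ofPath,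
          ofPath_mul_ofPath, Quiver.Path.toOp_comp]
      · rw [ofPath_mul_ofPath_of_ne _ _ h, opLinearEquiv_ofPath, opLinearEquiv_ofPath,
          ofPath_mul_ofPath_of_ne, map_zero]
        exact fun h' => h (Opposite.op_injective h').symm

/-- The opposite of `kV[ε]` is the algebra of dual numbers over the path algebra of the opposite
quiver. -/
def dualNumberOpEquiv (k : Type u) [Field k] (V : Type v) [Quiver.{w} V] [Fintype V] :
    ((PathAlgebra k V)[ε])ᵐᵒᵖ ≃+* (PathAlgebra k Vᵒᵖ)[ε] where
  toFun x := (opLinearEquiv k V x.unop.fst, opLinearEquiv k V x.unop.snd)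
  invFun x := .op ((opLinearEquiv k V).symm x.fst, (opLinearEquiv k V).symm x.snd)
  left_inv x := by
    apply MulOpposite.unop_injective
    ext
    · exact (opLinearEquiv k V).symm_apply_apply _
    · exact (opLinearEquiv k V).symm_apply_apply _
  right_inv x := by
    ext
    · exact (opLinearEquiv k V).apply_symm_apply _
    · exact (opLinearEquiv k V).apply_symm_apply _
  map_add' x y := by
    ext
    · exact map_add (opLinearEquiv k V) _ _
    · exact map_add (opLinearEquiv k V) _ _
  map_mul' x y := by
    ext
    · exact opLinearEquiv_mul _ _
    · change opLinearEquiv k V (y.unop.fst * x.unop.snd + y.unop.snd * x.unop.fst) =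
        opLinearEquiv k V x.unop.fst * opLinearEquiv k V y.unop.snd +
          opLinearEquiv k V x.unop.snd * opLinearEquiv k V y.unop.fst
      rw [map_add, opLinearEquiv_mul, opLinearEquiv_mul, add_comm]

end PathAlgebra

end Opposite

/-! ### Maps between modules over the dual numbers -/

section Maps

variable {R : Type u} [Ring R]

/-- The action of `a + b ε`, in terms of the actions of `R` and `ε`. -/
theorem dualNumber_smul (r : R[ε]) {M : ModuleCat.{v} R[ε]} (x : M) :
    r • x = dualInl R r.fst • x + dualInl R r.snd • (ε : R[ε]) • x := by
  rw [← mul_smul, ← add_smul]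
  congr 1
  ext <;> simp [dualInl]

/-- An `R`-linear map which commutes with the differentials is `R[ε]`-linear. -/
def homOfComm {M M' : ModuleCat.{v} R[ε]}
    (f : (underlying R).obj M →ₗ[R] (underlying R).obj M')
    (hf : ∀ x, f (differential M x) = differential M' (f x)) : M ⟶ M' :=
  ModuleCat.ofHom (X := M) (Y := M')
    { toFun := fun x : M => f x
      map_add' := fun x y : M => map_add f x y
      map_smul' := fun (r : R[ε]) (x : M) => by
        let F : M →+ M' := AddMonoidHomClass.toAddMonoidHom f
        have h1 : ∀ (s : R) (y : M), F (dualInl R s • y) = dualInl R s • F y :=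
          fun s y => f.map_smul s y
        have h2 : F ((ε : R[ε]) • x) = (ε : R[ε]) • F x := hf x
        change F (r • x) = r • F x
        rw [dualNumber_smul r x, dualNumber_smul r (F x), map_add, h1, h1, h2] }

/-- The `R[ε]`-linear map `x ↦ (a x, a (ε x))` from `M` to `N[ε]` which corresponds to an
`R`-linear map `a` from `M` to `N`. -/
def homToDualMod {M : ModuleCat.{v} R[ε]} {N : ModuleCat.{v} R}
    (a : (underlying R).obj M →ₗ[R] N) : M ⟶ dualMod N :=
  ModuleCat.ofHom (X := M) (Y := DualMod N)
    { toFun := fun x : M => ⟨a x, a (differential M x)⟩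
      map_add' := fun x y : M => by
        apply DualMod.ext'
        · exact map_add a _ _
        · exact (congrArg a (map_add (differential M) x y)).trans (map_add a _ _)
      map_smul' := fun (r : R[ε]) (x : M) => by
        have h1 : ∀ (s : R) (y : M), a (dualInl R s • y : M) = s • a y :=
          fun s y => a.map_smul s y
        have h3 : (ε : R[ε]) • (r • x) = dualInl R r.fst • ((ε : R[ε]) • x) := by
          rw [← mul_smul, ← mul_smul]
          congr 1
          ext <;> simp [dualInl]
        apply DualMod.ext'
        · change a (r • x : M) = r.fst • a x + r.snd • a ((ε : R[ε]) • x : M)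
          rw [dualNumber_smul]
          erw [map_add]
          rw [h1, h1]
        · change a ((ε : R[ε]) • (r • x) : M) = r.fst • a ((ε : R[ε]) • x : M)
          rw [h3, h1] }

theorem homToDualMod_apply {M : ModuleCat.{v} R[ε]} {N : ModuleCat.{v} R}
    (a : (underlying R).obj M →ₗ[R] N) (x : M) :
    (homToDualMod a).hom x = (⟨a x, a (differential M x)⟩ : DualMod N) := rfl

/-- The map `N[ε] → N'[ε]` induced by an `R`-linear map. -/
def dualModMap {N N' : Type v} [AddCommGroup N] [Module R N] [AddCommGroup N'] [Module R N']
    (f : N →ₗ[R] N') : DualMod N →ₗ[R[ε]] DualMod N' where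
  toFun x := ⟨f x.fst, f x.snd⟩
  map_add' x y := by ext <;> simp
  map_smul' r x := by ext <;> simp

/-- `N[ε]` is coinduced from `N`, so it is injective if `N` is. -/
theorem injective_dualMod (N : ModuleCat.{v} R) [Injective N] : Injective (dualMod N) where
  factors {X Y} g f hf := by
    have : Mono ((underlying R).map f) := by
      rw [ModuleCat.mono_iff_injective] at hf ⊢
      exact hf
    let p : (underlying R).obj X →ₗ[R] N :=
      { toFun := fun x : X => (g.hom x : DualMod N).fst
        map_add' := fun x y : X => by
          erw [map_add]
          rfl
        map_smul' := fun (r : R) (x : X) => by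
          have : g.hom (dualInl R r • x) = dualInl R r • g.hom x := map_smul _ _ _
          change (g.hom (dualInl R r • x) : DualMod N).fst = _
          rw [this]
          change r • (g.hom x : DualMod N).fst + (0 : R) • (g.hom x : DualMod N).snd = _
          rw [zero_smul, add_zero]
          rfl }
    obtain ⟨q, hq⟩ := Injective.factors (ModuleCat.ofHom p) ((underlying R).map f)
    refine ⟨homToDualMod q.hom, ?_⟩
    have hq' : ∀ x : X, q.hom (f.hom x) = (g.hom x : DualMod N).fst := fun x =>
      congrArg (fun t => t.hom x) hq
    ext x
    change (homToDualMod q.hom).hom (f.hom x) = g.hom x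
    rw [homToDualMod_apply]
    apply DualMod.ext'
    · exact hq' x
    · have : (ε : R[ε]) • f.hom x = f.hom ((ε : R[ε]) • x) := (map_smul f.hom _ _).symm
      change q.hom ((ε : R[ε]) • f.hom x) = _
      rw [this, hq']
      have h2 : g.hom ((ε : R[ε]) • x) = (ε : R[ε]) • g.hom x := map_smul g.hom _ _
      rw [h2]
      change (ε : R[ε]).fst • (g.hom x : DualMod N).fst + (ε : R[ε]).snd • (g.hom x : DualMod N).snd
        = _
      simp

/-- `R[ε]` is isomorphic, as a module over itself, to the coinduced module. -/
def dualModSelfEquiv : R[ε] ≃ₗ[R[ε]] DualMod R where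
  toFun x := ⟨x.snd, x.fst⟩
  invFun x := (x.snd, x.fst)
  left_inv x := rfl
  right_inv x := rfl
  map_add' x y := rfl
  map_smul' r x := by
    apply DualMod.ext'
    · change r.fst * x.snd + r.snd * x.fst = _
      rfl
    · rfl

end Maps

/-! ### Injective dimension -/

section Gorenstein

variable {R : Type u} [Ring R]

/-- Over a hereditary ring, quotients of injective modules are injective. -/
theorem SubmodulesProjective.injective_of_surjective (h : SubmodulesProjective R R)
    {I J : Type u} [AddCommGroup I] [Module R I] [AddCommGroup J] [Module R J]
    [Module.Injective R I] (f : I →ₗ[R] J) (hf : Function.Surjective f) : Module.Injective R J := by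
  refine Module.Baer.injective fun U g => ?_
  have := h U
  obtain ⟨g', hg'⟩ := Module.projective_lifting_property f g hf
  obtain ⟨t, ht⟩ := Module.Baer.of_injective ‹Module.Injective R I› U g'
  refine ⟨f ∘ₗ t, fun x hx => ?_⟩
  rw [LinearMap.comp_apply, ht x hx]
  exact LinearMap.congr_fun hg' _

/-- An injective resolution `0 → R → I → I / R → 0` over a hereditary ring gives the resolution
`0 → R[ε] → I[ε] → (I / R)[ε] → 0`. -/
theorem SubmodulesProjective.hasInjectiveDimensionLE_dualNumber (h : SubmodulesProjective R R) :
    HasInjectiveDimensionLE (ModuleCat.of R[ε] R[ε]) 1 := by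
  obtain ⟨⟨I, _, f, _⟩⟩ := EnoughInjectives.presentation (ModuleCat.of R R)
  have hf : Function.Injective f.hom := (ModuleCat.mono_iff_injective f).mp ‹_›
  let J : ModuleCat R := ModuleCat.of R (I ⧸ LinearMap.range f.hom)
  let g : I →ₗ[R] J := Submodule.mkQ _
  have hJ : Injective J := by
    have : Module.Injective R I := Module.injective_module_of_injective_object R I
    have := h.injective_of_surjective g (Submodule.mkQ_surjective _)
    exact Module.injective_object_of_injective_module R J
  have := injective_dualMod I
  have := injective_dualMod J
  have exact : Function.Exact (dualModMap f.hom) (dualModMap g) := by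
    intro x
    constructor
    · intro hx
      have h1 : g x.fst = 0 := congrArg DualMod.fst hx
      have h2 : g x.snd = 0 := congrArg DualMod.snd hx
      rw [← LinearMap.mem_ker, Submodule.ker_mkQ] at h1 h2
      obtain ⟨a, ha⟩ := h1
      obtain ⟨b, hb⟩ := h2
      exact ⟨⟨a, b⟩, DualMod.ext' ha hb⟩
    · rintro ⟨y, rfl⟩
      have : ∀ z, g (f.hom z) = 0 := fun z => by
        rw [← LinearMap.mem_ker, Submodule.ker_mkQ]
        exact ⟨z, rfl⟩
      exact DualMod.ext' (this _) (this _)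
  have S := ModuleCat.shortComplex_shortExact
    (ModuleCat.shortComplexOfCompEqZero (dualModMap f.hom) (dualModMap g)
      exact.linearMap_comp_eq_zero) exact
    (fun x y hxy => DualMod.ext' (hf (congrArg DualMod.fst hxy)) (hf (congrArg DualMod.snd hxy)))
    (fun x => by
      obtain ⟨a, ha⟩ := Submodule.mkQ_surjective _ x.fst
      obtain ⟨b, hb⟩ := Submodule.mkQ_surjective _ x.snd
      exact ⟨⟨a, b⟩, DualMod.ext' ha hb⟩)
  have h1 : HasInjectiveDimensionLT (dualMod J) 1 := inferInstance
  have h2 : HasInjectiveDimensionLT (dualMod I) 2 := inferInstance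
  have := S.hasInjectiveDimensionLT_X₁ 1 h1 h2
  exact hasInjectiveDimensionLT_of_iso (dualModSelfEquiv (R := R)).toModuleIso.symm 2

/-- Elements of injective modules can be divided, as far as annihilators permit. -/
theorem exists_smul_eq_of_injective {S : Type u} [Ring S] {M : Type u} [AddCommGroup M]
    [Module S M] [Module.Injective S M] (s : S) (m : M) (h : ∀ x : S, x * s = 0 → x • m = 0) :
    ∃ y : M, s • y = m := by
  obtain ⟨t, ht⟩ := Module.Injective.out
    ((LinearMap.ker (LinearMap.toSpanSingleton S S s)).liftQ (LinearMap.toSpanSingleton S S s)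
      le_rfl) (by
        rw [← LinearMap.ker_eq_bot]
        exact Submodule.ker_liftQ_eq_bot _ _ _ le_rfl)
    ((LinearMap.ker (LinearMap.toSpanSingleton S S s)).liftQ (LinearMap.toSpanSingleton S M m)
      fun x hx => h x hx)
  refine ⟨t 1, ?_⟩
  have : t ((1 : S) • s) = (1 : S) • m := ht (Submodule.Quotient.mk 1)
  rw [one_smul, one_smul] at this
  rw [← map_smul, smul_eq_mul, mul_one, this]

end Gorenstein

/-! ### Finiteness and projectivity of the underlying module -/

section Underlying

variable {R : Type u} [Ring R]

theorem isScalarTower_underlying (M : ModuleCat.{v} R[ε]) :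
    letI : Module R M := inferInstanceAs (Module R ((underlying R).obj M))
    IsScalarTower R R[ε] M :=
  letI : Module R M := inferInstanceAs (Module R ((underlying R).obj M))
  ⟨fun r s x => by
    change (r • s) • x = dualInl R r • s • x
    rw [← mul_smul]
    congr 1
    ext <;> simp [dualInl]⟩

theorem finite_underlying (M : ModuleCat.{v} R[ε]) [Module.Finite R[ε] M] :
    Module.Finite R ((underlying R).obj M) :=
  letI : Module R M := inferInstanceAs (Module R ((underlying R).obj M))
  have : IsScalarTower R R[ε] M := isScalarTower_underlying M
  have : Module.Finite R R[ε] := inferInstanceAs (Module.Finite R (R × R))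
  have h : Module.Finite R M := Module.Finite.trans R[ε] M
  h

theorem finite_of_underlying (M : ModuleCat.{v} R[ε])
    (h : Module.Finite R ((underlying R).obj M)) : Module.Finite R[ε] M :=
  letI : Module R M := inferInstanceAs (Module R ((underlying R).obj M))
  have : IsScalarTower R R[ε] M := isScalarTower_underlying M
  have : Module.Finite R M := h
  Module.Finite.of_restrictScalars_finite R R[ε] M

theorem fgModules_homology [IsNoetherianRing R] (M : ModuleCat.{u} R[ε])
    (hM : fgModules R[ε] M) : fgModules R ((homology R).obj M) := by
  have : Module.Finite R[ε] M := hM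
  have := finite_underlying M
  exact inferInstanceAs (Module.Finite R (cycles M ⧸ boundaries M))

/-- A finitely generated submodule of a free module only involves finitely many coordinates. -/
theorem exists_injective_pi_of_injective_finsupp {S : Type*} [Ring S] {M : Type*} [AddCommGroup M]
    [Module S M] [Module.Finite S M] {ι : Type*} (g : M →ₗ[S] ι →₀ S)
    (hg : Function.Injective g) :
    ∃ s : Finset ι, Function.Injective fun m (i : s) => g m i := by
  classical
  obtain ⟨T, hT⟩ := Module.Finite.fg_top (R := S) (M := M)
  refine ⟨T.biUnion fun m => (g m).support, fun m m' h => hg ?_⟩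
  have key : ∀ m, g m ∈ Finsupp.supported S S (T.biUnion fun m => (g m).support : Set ι) := by
    intro m
    have : Submodule.span S (T : Set M) ≤
        (Finsupp.supported S S (T.biUnion fun m => (g m).support : Set ι)).comap g := by
      rw [Submodule.span_le]
      intro m hm
      refine (Finsupp.mem_supported S (g m)).2 ?_
      exact_mod_cast Finset.subset_biUnion_of_mem (fun m => (g m).support) hm
    exact this (hT ▸ Submodule.mem_top)
  ext i
  by_cases hi : i ∈ T.biUnion fun m => (g m).support
  · exact congrFun h ⟨i, hi⟩
  · rw [(Finsupp.mem_supported' S (g m)).1 (key m) i (by exact_mod_cast hi),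
      (Finsupp.mem_supported' S (g m')).1 (key m') i (by exact_mod_cast hi)]

/-- A finitely generated torsionless module embeds into a finite free one, whose underlying
`R`-module is finite free as well. -/
theorem torsionless.submodulesProjective (hR : SubmodulesProjective R R) {M : ModuleCat.{u} R[ε]}
    (hM : torsionless R[ε] M) : SubmodulesProjective R ((underlying R).obj M) := by
  obtain ⟨_, P, f, hP, hf⟩ := hM
  obtain ⟨s, hs⟩ := Module.projective_def'.1 hP
  have hs' : Function.Injective s := fun x y h => by
    have := congrArg (Finsupp.linearCombination R[ε] id) h
    exact (LinearMap.congr_fun hs x).symm.trans (this.trans (LinearMap.congr_fun hs y))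
  obtain ⟨t, ht⟩ := exists_injective_pi_of_injective_finsupp (s ∘ₗ f) (hs'.comp hf)
  have h : SubmodulesProjective R (t → R × R) := SubmodulesProjective.pi fun _ => hR.prod hR
  refine h.of_injective
    { toFun := fun m : M => fun i : t => ((s (f m) i).fst, (s (f m) i).snd)
      map_add' := fun x y : M => by
        have h : s (f (x + y)) = s (f x) + s (f y) := by rw [map_add, map_add]
        funext i
        exact Prod.ext (congrArg (fun q => (q i).fst) h) (congrArg (fun q => (q i).snd) h)
      map_smul' := fun (r : R) (x : M) => by
        have h : s (f (dualInl R r • x)) = dualInl R r • s (f x) := by rw [map_smul, map_smul]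
        have h' : s (f (r • (show (underlying R).obj M from x) : (underlying R).obj M)) =
          dualInl R r • s (f x) := h
        ext i
        · simp [h', dualInl]
        · simp [h', dualInl] } ?_
  intro m m' h
  apply ht
  ext i
  · exact congrArg Prod.fst (congrFun h i)
  · exact congrArg Prod.snd (congrFun h i)

/-- The map `(x, y) ↦ ε f(x) + f(y)` from `N[ε]` to `M` which corresponds to an `R`-linear map `f`
from `N` to `M`. -/
def homFromDualMod {M : ModuleCat.{v} R[ε]} {N : ModuleCat.{v} R}
    (f : N →ₗ[R] (underlying R).obj M) : dualMod N ⟶ M :=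
  ModuleCat.ofHom (X := DualMod N) (Y := M)
    { toFun := fun z => (ε : R[ε]) • (show M from f z.fst) + (show M from f z.snd)
      map_add' := fun z z' => by
        let F : N →+ M := AddMonoidHomClass.toAddMonoidHom f
        change (ε : R[ε]) • F (z.fst + z'.fst) + F (z.snd + z'.snd) =
          ((ε : R[ε]) • F z.fst + F z.snd) + ((ε : R[ε]) • F z'.fst + F z'.snd)
        rw [map_add, map_add, smul_add]
        abel
      map_smul' := fun r z => by
        let F : N →+ M := AddMonoidHomClass.toAddMonoidHom f
        have h1 : ∀ (s : R) (y : N), F (s • y) = dualInl R s • F y := fun s y => f.map_smul s y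
        change (ε : R[ε]) • F (r.fst • z.fst + r.snd • z.snd) + F (r.fst • z.snd) =
          r • ((ε : R[ε]) • F z.fst + F z.snd)
        rw [map_add, h1, h1, h1, smul_add, smul_add, add_assoc, ← mul_smul, ← mul_smul, ← mul_smul,
          ← add_smul]
        congr 2
        · ext <;> simp [dualInl]
        · ext <;> simp [dualInl] }

/-- `P[ε]` is induced from `P`, so it is projective if `P` is. -/
theorem projective_dualMod (P : Type u) [AddCommGroup P] [Module R P] [Module.Projective R P] :
    Module.Projective R[ε] (DualMod P) := by
  refine Module.Projective.of_lifting_property'' fun F hF => ?_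
  let Y : ModuleCat.{u} R[ε] := ModuleCat.of R[ε] (DualMod P →₀ R[ε])
  let F' : Y ⟶ dualMod (ModuleCat.of R P) := ModuleCat.ofHom F
  let c : ModuleCat.of R P →ₗ[R] (underlying R).obj (dualMod (ModuleCat.of R P)) :=
    { toFun := fun y => (⟨0, y⟩ : DualMod P)
      map_add' := fun x y => DualMod.ext' (add_zero (0 : P)).symm rfl
      map_smul' := fun r y => DualMod.ext'
        (show (0 : P) = r • (0 : P) + (0 : R) • y by simp) rfl }
  obtain ⟨h0, hh0⟩ := Module.projective_lifting_property ((underlying R).map F').hom c hF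
  refine ⟨(homFromDualMod h0).hom, ?_⟩
  have hF0 : ∀ y : P, F (h0 y) = ⟨0, y⟩ := fun y => LinearMap.congr_fun hh0 y
  ext1 z
  change F ((ε : R[ε]) • (show Y from h0 z.fst) + (show Y from h0 z.snd)) = z
  rw [map_add, map_smul]
  erw [hF0, hF0]
  ext <;> simp

theorem differential_differential (M : ModuleCat.{v} R[ε]) (x : (underlying R).obj M) :
    differential M (differential M x) = 0 := by
  have : (ε : R[ε]) • ((ε : R[ε]) • (show M from x)) = 0 := by
    rw [← mul_smul, DualNumber.eps_mul_eps, zero_smul]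
  exact this

/-- If the homology vanishes and the boundaries form a projective module, then a section of `ε`
over the boundaries identifies `M` with an induced module. -/
theorem projective_of_exact {M : ModuleCat.{u} R[ε]}
    (hM : SubmodulesProjective R ((underlying R).obj M))
    (hex : LinearMap.ker (differential M) ≤ LinearMap.range (differential M)) :
    Module.Projective R[ε] M := by
  let B : ModuleCat.{u} R := ModuleCat.of R (LinearMap.range (differential M))
  have hB : Module.Projective R B := hM _
  obtain ⟨s, hs⟩ := Module.projective_lifting_property (differential M).rangeRestrict LinearMap.id
    (differential M).surjective_rangeRestrict
  have hs' : ∀ y, differential M (s y) = y := fun y => congrArg Subtype.val (LinearMap.congr_fun hs y)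
  let F : DualMod B →ₗ[R[ε]] M := (homFromDualMod (N := B) s).hom
  have hF : ∀ z : DualMod B, F z = (show M from (z.fst.1 + s z.snd : (underlying R).obj M)) :=
    fun z => congrArg (fun t => t + s z.snd) (hs' z.fst)
  have hbij : Function.Bijective F := by
    constructor
    · rw [injective_iff_map_eq_zero]
      intro z hz
      have hz' : (z.fst.1 + s z.snd : (underlying R).obj M) = 0 := (hF z).symm.trans hz
      have h2 : z.snd = 0 := by
        have := congrArg (differential M) hz'
        obtain ⟨x, hx⟩ := z.fst.2
        rw [map_add, hs', ← hx, differential_differential, zero_add, map_zero] at this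
        exact Subtype.ext this
      have h1 : z.fst = 0 := by
        rw [h2, map_zero, add_zero] at hz'
        exact Subtype.ext hz'
      exact DualMod.ext' h1 h2
    · intro m
      let m' : (underlying R).obj M := m
      have hm : m' - s ((differential M).rangeRestrict m') ∈ LinearMap.ker (differential M) := by
        rw [LinearMap.mem_ker, map_sub, hs']
        exact sub_self _
      refine ⟨⟨⟨_, hex hm⟩, (differential M).rangeRestrict m'⟩, ?_⟩
      rw [hF]
      exact sub_add_cancel m' _
  have := projective_dualMod (R := R) B
  exact Module.Projective.of_equiv (LinearEquiv.ofBijective F hbij)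

end Underlying

/-! ### Homology is full on torsionless modules -/

section Full

variable {R : Type u} [Ring R]

/-- The cycles and the boundaries of `M` are projective.  So a map on homology lifts to a map on
cycles, and the latter extends to `M` since `M` splits into its cycles and a complement which `ε`
maps isomorphically to the boundaries. -/
theorem exists_homology_map_eq {M M' : ModuleCat.{u} R[ε]}
    (hM : SubmodulesProjective R ((underlying R).obj M))
    (φ : (homology R).obj M ⟶ (homology R).obj M') :
    ∃ f : M ⟶ M', (homology R).map f = φ := by
  have := hM (cycles M)
  have := hM (LinearMap.range (differential M))
  let φ' : (cycles M ⧸ boundaries M) →ₗ[R] cycles M' ⧸ boundaries M' := φ.hom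
  obtain ⟨φ₁, hφ₁⟩ := Module.projective_lifting_property (boundaries M').mkQ
    (φ' ∘ₗ (boundaries M).mkQ) (Submodule.mkQ_surjective _)
  have hφ₁' : ∀ z, (boundaries M').mkQ (φ₁ z) = φ' ((boundaries M).mkQ z) :=
    LinearMap.congr_fun hφ₁
  obtain ⟨s, hs⟩ := Module.projective_lifting_property (differential M).rangeRestrict LinearMap.id
    (differential M).surjective_rangeRestrict
  have hs' : ∀ y, differential M (s y) = y := fun y => congrArg Subtype.val (LinearMap.congr_fun hs y)
  have hBZ : LinearMap.range (differential M) ≤ cycles M := by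
    rintro _ ⟨x, rfl⟩
    exact differential_differential M x
  let β : LinearMap.range (differential M) →ₗ[R] LinearMap.range (differential M') :=
    ((cycles M').subtype ∘ₗ φ₁ ∘ₗ Submodule.inclusion hBZ).codRestrict _ fun b => by
      have : φ₁ (Submodule.inclusion hBZ b) ∈ boundaries M' := by
        rw [← Submodule.ker_mkQ (boundaries M'), LinearMap.mem_ker, hφ₁']
        have : (boundaries M).mkQ (Submodule.inclusion hBZ b) = 0 := by
          rw [← LinearMap.mem_ker, Submodule.ker_mkQ]
          exact b.2
        rw [this, map_zero]
      exact this
  obtain ⟨t, ht⟩ := Module.projective_lifting_property (differential M').rangeRestrict β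
    (differential M').surjective_rangeRestrict
  have ht' : ∀ b, differential M' (t b) = φ₁ (Submodule.inclusion hBZ b) :=
    fun b => congrArg Subtype.val (LinearMap.congr_fun ht b)
  -- The projection of `M` onto its cycles along the image of the section `s`.
  let π : (underlying R).obj M →ₗ[R] cycles M :=
    (LinearMap.id - s ∘ₗ (differential M).rangeRestrict).codRestrict _ fun x => by
      rw [LinearMap.mem_ker, LinearMap.sub_apply, map_sub, LinearMap.comp_apply, hs']
      exact sub_self _
  let ψ : (underlying R).obj M →ₗ[R] (underlying R).obj M' :=
    (cycles M').subtype ∘ₗ φ₁ ∘ₗ π + t ∘ₗ (differential M).rangeRestrict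
  have hψ : ∀ z : cycles M, ψ z = φ₁ z := fun z => by
    have h0 : (differential M).rangeRestrict z = 0 := Subtype.ext z.2
    have h1 : π z = z := by
      apply Subtype.ext
      change (z : (underlying R).obj M) - s ((differential M).rangeRestrict z) = z
      rw [h0, map_zero, sub_zero]
    change ((φ₁ (π z) : cycles M') : (underlying R).obj M') + t ((differential M).rangeRestrict z) = _
    rw [h0, h1, map_zero, add_zero]
  refine ⟨homOfComm ψ fun x => ?_, ?_⟩
  · rw [show ψ (differential M x) = φ₁ ⟨differential M x, differential_differential M x⟩ from
      hψ ⟨differential M x, differential_differential M x⟩]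
    change _ = differential M' (((φ₁ (π x) : cycles M') : (underlying R).obj M') +
      t ((differential M).rangeRestrict x))
    rw [map_add, ht', show differential M' (φ₁ (π x)) = 0 from (φ₁ (π x)).2, zero_add]
    rfl
  · ext x
    obtain ⟨z, rfl⟩ := Submodule.mkQ_surjective _ x
    refine Eq.trans ?_ (hφ₁' z)
    change (boundaries M').mkQ (cyclesMap (homOfComm ψ _) z) = _
    congr 1
    exact Subtype.ext (hψ z)

end Full

/-! ### Maps to modules annihilated by the differential -/

section FromHomology

variable {R : Type u} [Ring R]

theorem eps_smul_trivialDiff {N : ModuleCat.{v} R} (x : (trivialDiff R).obj N) :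
    (ε : R[ε]) • x = 0 := by
  change (ε : R[ε]).fst • (show N from x) = 0
  rw [DualNumber.fst_eps, zero_smul]

/-- A map to a module annihilated by `ε`, as an `R`-linear map. -/
def linearOfTrivial {M : ModuleCat.{v} R[ε]} {N : ModuleCat.{v} R} (g : M ⟶ (trivialDiff R).obj N) :
    (underlying R).obj M →ₗ[R] N where
  toFun x := g.hom (show M from x)
  map_add' x y := map_add g.hom (show M from x) (show M from y)
  map_smul' r x := map_smul g.hom (dualInl R r) (show M from x)

theorem linearOfTrivial_differential {M : ModuleCat.{v} R[ε]} {N : ModuleCat.{v} R}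
    (g : M ⟶ (trivialDiff R).obj N) (x : (underlying R).obj M) :
    linearOfTrivial g (differential M x) = 0 :=
  (map_smul g.hom (ε : R[ε]) (show M from x)).trans (eps_smul_trivialDiff _)

/-- A map from `M` to a module `N` annihilated by `ε` induces a map from `H(M)` to `N`. -/
def fromHomology {M : ModuleCat.{v} R[ε]} {N : ModuleCat.{v} R} (g : M ⟶ (trivialDiff R).obj N) :
    (homology R).obj M ⟶ N :=
  ModuleCat.ofHom ((boundaries M).liftQ (linearOfTrivial g ∘ₗ (cycles M).subtype) <| by
    rintro ⟨x, hx⟩ ⟨y, hy⟩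
    change linearOfTrivial g x = 0
    rw [← linearOfTrivial_differential g y]
    exact congrArg _ hy.symm)

theorem homology_map_comp_fromHomology {M M' : ModuleCat.{v} R[ε]} {N : ModuleCat.{v} R}
    (f : M ⟶ M') (g : M' ⟶ (trivialDiff R).obj N) :
    (homology R).map f ≫ fromHomology g = fromHomology (f ≫ g) := by
  ext x
  obtain ⟨z, rfl⟩ := Submodule.mkQ_surjective _ x
  rfl

/-- The two hypotheses say that the restriction of `g` to the cycles is surjective, and that its
kernel consists of boundaries. -/
theorem isIso_fromHomology {M : ModuleCat.{v} R[ε]} {N : ModuleCat.{v} R}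
    (g : M ⟶ (trivialDiff R).obj N) (hs : ∀ y : N, ∃ z : cycles M, linearOfTrivial g z = y)
    (hi : ∀ z : cycles M, linearOfTrivial g z = 0 → z ∈ boundaries M) :
    IsIso (fromHomology g) := by
  rw [ConcreteCategory.isIso_iff_bijective]
  constructor
  · change Function.Injective (fromHomology g).hom
    rw [injective_iff_map_eq_zero]
    intro x hx
    obtain ⟨z, rfl⟩ := Submodule.mkQ_surjective _ x
    have := hi z hx
    rwa [← Submodule.ker_mkQ (boundaries M)] at this
  · intro y
    obtain ⟨z, hz⟩ := hs y
    exact ⟨(boundaries M).mkQ z, hz⟩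

theorem isIso_fromHomology_id (N : ModuleCat.{v} R) :
    IsIso (fromHomology (𝟙 ((trivialDiff R).obj N))) := by
  refine isIso_fromHomology _ (fun y => ⟨⟨y, eps_smul_trivialDiff _⟩, rfl⟩) fun z hz => ?_
  have : z = 0 := Subtype.ext hz
  rw [this]
  exact zero_mem _

/-- Every map from `H(M)` to `N` comes from a map from `M` to `N`, since homology is full and
`H(N) = N`. -/
theorem exists_fromHomology_eq {M : ModuleCat.{u} R[ε]}
    (hM : SubmodulesProjective R ((underlying R).obj M)) {N : ModuleCat.{u} R}
    (φ : (homology R).obj M ⟶ N) :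
    ∃ g : M ⟶ (trivialDiff R).obj N, fromHomology g = φ := by
  have := isIso_fromHomology_id N
  obtain ⟨g, hg⟩ := exists_homology_map_eq hM (φ ≫ inv (fromHomology (𝟙 ((trivialDiff R).obj N))))
  refine ⟨g, ?_⟩
  rw [← Category.comp_id g, ← homology_map_comp_fromHomology, hg, Category.assoc,
    IsIso.inv_hom_id, Category.comp_id]

end FromHomology

/-! ### The approximation given by a projective cover -/

section Approximation

variable {R : Type u} [Ring R]

section

variable {P N : ModuleCat.{v} R} (p : P ⟶ N)

/-- For `p : P → N` with kernel `Ω`, the submodule `P ⊕ Ω` of `P[ε]`.  It is the pushout of `P`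
and `Ω[ε]` along `Ω`. -/
def approxSubmodule : Submodule R[ε] (DualMod P) where
  carrier := {z | p.hom z.snd = 0}
  add_mem' {x y} hx hy := by
    change p.hom (x.snd + y.snd) = 0
    rw [map_add, show p.hom x.snd = 0 from hx, show p.hom y.snd = 0 from hy, add_zero]
  zero_mem' := map_zero p.hom
  smul_mem' r x hx := by
    change p.hom (r.fst • x.snd) = 0
    rw [map_smul, show p.hom x.snd = 0 from hx, smul_zero]

/-- The `R[ε]`-module `P ⊕ Ω` with `ε (x, y) = (y, 0)`, where `Ω` is the kernel of `p : P → N`. -/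
def approxObj : ModuleCat.{v} R[ε] := ModuleCat.of R[ε] (approxSubmodule p)

/-- The map `P ⊕ Ω → N`, `(x, y) ↦ p(x)`. -/
def approxMap : approxObj p ⟶ (trivialDiff R).obj N :=
  ModuleCat.ofHom (X := approxSubmodule p) (Y := (trivialDiff R).obj N)
    { toFun := fun z => (show N from p.hom z.1.fst)
      map_add' := fun x y => map_add p.hom x.1.fst y.1.fst
      map_smul' := fun r x => by
        change p.hom (r.fst • x.1.fst + r.snd • x.1.snd) = r.fst • p.hom x.1.fst
        rw [map_add, map_smul, map_smul, show p.hom x.1.snd = 0 from x.2, smul_zero, add_zero] }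

/-- The inclusion `P → P ⊕ Ω`. -/
def approxInl : (trivialDiff R).obj P ⟶ approxObj p :=
  ModuleCat.ofHom (X := (trivialDiff R).obj P) (Y := approxSubmodule p)
    (((toDualMod P).hom : (trivialDiff R).obj P →ₗ[R[ε]] DualMod P).codRestrict _
      fun _ => map_zero p.hom)

/-- The inclusion `Ω[ε] → P ⊕ Ω`. -/
def approxInr : dualMod (ModuleCat.of R (LinearMap.ker p.hom)) ⟶ approxObj p :=
  ModuleCat.ofHom (X := DualMod (LinearMap.ker p.hom)) (Y := approxSubmodule p)
    ((dualModMap (LinearMap.ker p.hom).subtype).codRestrict _ fun z => z.snd.2)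

theorem approxInl_comp_approxMap : approxInl p ≫ approxMap p = (trivialDiff R).map p := rfl

theorem approxInr_comp_approxMap : approxInr p ≫ approxMap p = 0 := by
  ext z
  exact (show DualMod (LinearMap.ker p.hom) from z).fst.2

/-- The map out of `P ⊕ Ω` given by compatible maps on `P` and on `Ω[ε]`. -/
def approxDesc {T : ModuleCat.{v} R[ε]} (a : (trivialDiff R).obj P ⟶ T)
    (b : dualMod (ModuleCat.of R (LinearMap.ker p.hom)) ⟶ T)
    (h : (trivialDiff R).map (ModuleCat.ofHom (LinearMap.ker p.hom).subtype) ≫ a =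
      toDualMod (ModuleCat.of R (LinearMap.ker p.hom)) ≫ b) : approxObj p ⟶ T :=
  ModuleCat.ofHom (X := approxSubmodule p) (Y := T)
    { toFun := fun z => a.hom (show (trivialDiff R).obj P from z.1.fst) +
        b.hom (show DualMod (LinearMap.ker p.hom) from ⟨0, ⟨z.1.snd, z.2⟩⟩)
      map_add' := fun x y => by
        let A : P →+ T := AddMonoidHomClass.toAddMonoidHom a.hom
        let B : DualMod (LinearMap.ker p.hom) →+ T := AddMonoidHomClass.toAddMonoidHom b.hom
        change A (x.1.fst + y.1.fst) + B ⟨0, ⟨x.1.snd, x.2⟩ + ⟨y.1.snd, y.2⟩⟩ =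
          (A x.1.fst + B ⟨0, ⟨x.1.snd, x.2⟩⟩) + (A y.1.fst + B ⟨0, ⟨y.1.snd, y.2⟩⟩)
        have : (⟨0, ⟨x.1.snd, x.2⟩ + ⟨y.1.snd, y.2⟩⟩ : DualMod (LinearMap.ker p.hom)) =
            ⟨0, ⟨x.1.snd, x.2⟩⟩ + ⟨0, ⟨y.1.snd, y.2⟩⟩ := DualMod.ext' (add_zero 0).symm rfl
        rw [this, map_add, map_add]
        abel
      map_smul' := fun r x => by
        let A : P →+ T := AddMonoidHomClass.toAddMonoidHom a.hom
        let B : DualMod (LinearMap.ker p.hom) →+ T := AddMonoidHomClass.toAddMonoidHom b.hom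
        let y : LinearMap.ker p.hom := ⟨x.1.snd, x.2⟩
        have hA : ∀ (r : R[ε]) (t : P), A (r.fst • t) = r • A t :=
          fun r t => map_smul a.hom r (show (trivialDiff R).obj P from t)
        have hB : ∀ (r : R[ε]) (t : DualMod (LinearMap.ker p.hom)), B (r • t) = r • B t :=
          fun r t => map_smul b.hom r t
        have hAB : ∀ t : LinearMap.ker p.hom, A t = B ⟨t, 0⟩ :=
          fun t => congrArg (fun f => f.hom t) h
        change A (r.fst • x.1.fst + r.snd • x.1.snd) + B ⟨0, r.fst • y⟩ =
          r • (A x.1.fst + B ⟨0, y⟩)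
        rw [map_add, hA, smul_add, ← hB, add_assoc]
        congr 1
        rw [show r.snd • x.1.snd = ((r.snd • y : LinearMap.ker p.hom) : P) from rfl, hAB, ← map_add]
        congr 1
        ext1 <;> simp }

theorem isPushout_approx :
    IsPushout ((trivialDiff R).map (ModuleCat.ofHom (LinearMap.ker p.hom).subtype))
      (toDualMod (ModuleCat.of R (LinearMap.ker p.hom))) (approxInl p) (approxInr p) := by
  refine ⟨⟨?_⟩, ⟨Limits.PushoutCocone.IsColimit.mk _ (fun s => approxDesc p s.inl s.inr s.condition)
    (fun s => ?_) (fun s => ?_) fun s m h1 h2 => ?_⟩⟩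
  · ext x
    apply Subtype.ext
    exact DualMod.ext' rfl rfl
  · ext x
    let B : DualMod (LinearMap.ker p.hom) →+ s.pt := AddMonoidHomClass.toAddMonoidHom s.inr.hom
    change s.inl.hom x + B 0 = s.inl.hom x
    rw [map_zero, add_zero]
  · ext x
    let B : DualMod (LinearMap.ker p.hom) →+ s.pt := AddMonoidHomClass.toAddMonoidHom s.inr.hom
    let A : P →+ s.pt := AddMonoidHomClass.toAddMonoidHom s.inl.hom
    have hAB : ∀ t : LinearMap.ker p.hom, A t = B ⟨t, 0⟩ :=
      fun t => congrArg (fun f => f.hom t) s.condition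
    let x' : DualMod (LinearMap.ker p.hom) := x
    change A x'.fst + B ⟨0, x'.snd⟩ = B x'
    rw [hAB, ← map_add]
    congr 1
    exact DualMod.ext' (add_zero _) (zero_add _)
  · ext z
    let z' : approxSubmodule p := z
    let M : approxSubmodule p →+ s.pt := AddMonoidHomClass.toAddMonoidHom m.hom
    have h1' : s.inl.hom (show (trivialDiff R).obj P from z'.1.fst) =
      M ⟨⟨z'.1.fst, 0⟩, map_zero p.hom⟩ := (congrArg (fun f => f.hom z'.1.fst) h1).symm
    have h2' : s.inr.hom (show DualMod (LinearMap.ker p.hom) from ⟨0, ⟨z'.1.snd, z'.2⟩⟩) =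
      M ⟨⟨0, z'.1.snd⟩, z'.2⟩ :=
      (congrArg (fun f => f.hom (⟨0, ⟨z'.1.snd, z'.2⟩⟩ : DualMod (LinearMap.ker p.hom))) h2).symm
    change M z' = s.inl.hom (show (trivialDiff R).obj P from z'.1.fst) +
        s.inr.hom (show DualMod (LinearMap.ker p.hom) from ⟨0, ⟨z'.1.snd, z'.2⟩⟩)
    rw [h1', h2', ← map_add]
    congr 1
    apply Subtype.ext
    exact DualMod.ext' (add_zero _).symm (zero_add _).symm

theorem differential_approxObj (x : approxSubmodule p) :
    (differential (approxObj p) x : (underlying R).obj (approxObj p)) =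
      (⟨⟨x.1.snd, 0⟩, map_zero p.hom⟩ : approxSubmodule p) := by
  apply Subtype.ext
  change (ε : R[ε]) • x.1 = (⟨x.1.snd, 0⟩ : DualMod P)
  ext <;> simp

theorem isIso_fromHomology_approxMap (hp : Function.Surjective p.hom) :
    IsIso (fromHomology (approxMap p)) := by
  refine isIso_fromHomology _ (fun y => ?_) fun z hz => ?_
  · obtain ⟨x, rfl⟩ := hp y
    exact ⟨⟨(⟨⟨x, 0⟩, map_zero p.hom⟩ : approxSubmodule p), differential_approxObj p _⟩, rfl⟩
  · let z' : approxSubmodule p := z.1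
    have hz' : z'.1.snd = 0 := by
      have h := (differential_approxObj p z').symm.trans z.2
      exact congrArg (fun t : approxSubmodule p => t.1.fst) h
    refine ⟨(⟨⟨0, z'.1.fst⟩, hz⟩ : approxSubmodule p), ?_⟩
    refine (differential_approxObj p _).trans ?_
    change _ = z'
    apply Subtype.ext
    exact DualMod.ext' rfl hz'.symm

end

variable {P N : ModuleCat.{u} R} (p : P ⟶ N)

theorem torsionless_approxObj [IsNoetherianRing R] [Module.Finite R P] [Module.Projective R P] :
    torsionless R[ε] (approxObj p) := by
  refine ⟨finite_of_underlying _ ?_, ModuleCat.of R[ε] (DualMod P), (approxSubmodule p).subtype,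
    projective_dualMod P, Subtype.val_injective⟩
  let f : (underlying R).obj (approxObj p) →ₗ[R] P × P :=
    { toFun := fun z : approxSubmodule p => (z.1.fst, z.1.snd)
      map_add' := fun x y => rfl
      map_smul' := fun r x => by
        let x' : approxSubmodule p := x
        change (r • x'.1.fst + (0 : R) • x'.1.snd, r • x'.1.snd) = (r • x'.1.fst, r • x'.1.snd)
        rw [zero_smul, add_zero] }
  refine Module.Finite.of_injective f fun x y h => Subtype.ext ?_
  exact DualMod.ext' (congrArg Prod.fst h) (congrArg Prod.snd h)

/-- An `R`-linear lift `a : M → P` of a map `h : M → N` gives the lift `x ↦ (a x, a (ε x))`. -/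
theorem exists_lift_approxMap (hp : Function.Surjective p.hom) {M : ModuleCat.{u} R[ε]}
    (hM : Module.Projective R ((underlying R).obj M)) (h : M ⟶ (trivialDiff R).obj N) :
    ∃ h' : M ⟶ approxObj p, h' ≫ approxMap p = h := by
  obtain ⟨a, ha⟩ := Module.projective_lifting_property p.hom (linearOfTrivial h) hp
  have ha' : ∀ x, p.hom (a x) = linearOfTrivial h x := LinearMap.congr_fun ha
  refine ⟨ModuleCat.ofHom (X := M) (Y := approxSubmodule p)
    (((homToDualMod a).hom : M →ₗ[R[ε]] DualMod P).codRestrict _ fun x => ?_), ?_⟩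
  · exact (ha' _).trans (linearOfTrivial_differential h x)
  · ext x
    exact ha' x

/-- If `p` is a projective cover, then an endomorphism of `P ⊕ Ω` which is invertible on homology
is invertible on `P` since the kernel of `p` is superfluous. -/
theorem isIso_of_isIso_homology_map [IsNoetherianRing R] [IsArtinianRing R] (hp : IsProjCover p)
    (φ : approxObj p ⟶ approxObj p) (hφ : IsIso ((homology R).map φ)) : IsIso φ := by
  have := hp.finite
  have := hp.projective
  have := isIso_fromHomology_approxMap p hp.surjective
  let φ' : approxSubmodule p →ₗ[R[ε]] approxSubmodule p := φ.hom
  let c : P → approxSubmodule p := fun x => ⟨⟨x, 0⟩, map_zero p.hom⟩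
  have hc : ∀ x : approxSubmodule p, (ε : R[ε]) • x = c x.1.snd := differential_approxObj p
  have hφc : ∀ x, φ' (c x) = c (φ' (c x)).1.fst := by
    intro x
    have h1 : (ε : R[ε]) • c x = 0 := hc (c x)
    have h2 := congrArg φ' h1
    rw [map_smul, hc, map_zero] at h2
    have h3 : (φ' (c x)).1.snd = 0 := congrArg (fun t : approxSubmodule p => t.1.fst) h2
    exact Subtype.ext (DualMod.ext' rfl h3)
  let α : P →ₗ[R] P :=
    { toFun := fun x => (φ' (c x)).1.fst
      map_add' := fun x y => by
        have : c (x + y) = c x + c y := Subtype.ext (DualMod.ext' rfl (add_zero 0).symm)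
        rw [this, map_add]
        rfl
      map_smul' := fun r x => by
        have : c (r • x) = dualInl R r • c x :=
          Subtype.ext (DualMod.ext' (show r • x = r • x + (0 : R) • (0 : P) by simp)
            (smul_zero r).symm)
        rw [this, map_smul]
        change r • (φ' (c x)).1.fst + (0 : R) • (φ' (c x)).1.snd = r • (φ' (c x)).1.fst
        rw [zero_smul, add_zero] }
  have hα : Function.Surjective α := by
    rw [← LinearMap.range_eq_top]
    apply hp.superfluous
    rw [eq_top_iff]
    rintro x -
    obtain ⟨y, hy⟩ := (ConcreteCategory.isIso_iff_bijective ((homology R).map φ)).1 hφ |>.2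
      ((boundaries (approxObj p)).mkQ ⟨c x, hc (c x)⟩)
    obtain ⟨z, rfl⟩ := Submodule.mkQ_surjective _ y
    have hz : (z.1 : approxSubmodule p) = c (z.1 : approxSubmodule p).1.fst := by
      have h := (hc z.1).symm.trans z.2
      have h' : (z.1 : approxSubmodule p).1.snd = 0 :=
        congrArg (fun t : approxSubmodule p => t.1.fst) h
      exact Subtype.ext (DualMod.ext' rfl h')
    have h4 : p.hom (φ' z.1).1.fst = p.hom x :=
      congrArg (fun t => (fromHomology (approxMap p)).hom t) hy
    rw [hz] at h4
    refine Submodule.mem_sup.2 ⟨α (z.1 : approxSubmodule p).1.fst, ⟨_, rfl⟩,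
      x - α (z.1 : approxSubmodule p).1.fst, ?_, add_sub_cancel _ _⟩
    rw [LinearMap.mem_ker, map_sub, sub_eq_zero]
    exact h4.symm
  have hα' : Function.Injective α := (OrzechProperty.injective_of_surjective_endomorphism α hα)
  have hφi : Function.Injective φ' := by
    rw [injective_iff_map_eq_zero]
    intro z hz
    have h1 : φ' (c z.1.snd) = 0 := by rw [← hc, map_smul, hz, smul_zero]
    have h2 : z.1.snd = 0 := by
      apply hα'
      rw [map_zero]
      exact congrArg (fun t : approxSubmodule p => t.1.fst) h1
    have h3 : z = c z.1.fst := Subtype.ext (DualMod.ext' rfl h2)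
    rw [h3] at hz
    have h4 : z.1.fst = 0 := by
      apply hα'
      rw [map_zero]
      exact congrArg (fun t : approxSubmodule p => t.1.fst) hz
    exact Subtype.ext (DualMod.ext' h4 h2)
  have := (torsionless_approxObj p).1
  have := finite_underlying (approxObj p)
  rw [ConcreteCategory.isIso_iff_bijective]
  exact IsArtinian.bijective_of_injective_endomorphism ((underlying R).map φ).hom hφi

/-- An endomorphism of `P ⊕ Ω` over `N` is the identity on homology, because the homology of
`P ⊕ Ω` is `N`. -/
theorem isMinimalRightApprox_approxMap [IsNoetherianRing R] [IsArtinianRing R]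
    (hR : SubmodulesProjective R R) (hp : IsProjCover p) :
    IsMinimalRightApprox (torsionless R[ε]) (approxMap p) where
  mem := by
    have := hp.finite
    have := hp.projective
    exact torsionless_approxObj p
  factors _ hY h := exists_lift_approxMap p hp.surjective (hY.submodulesProjective hR).projective h
  minimal φ hφ := by
    have := isIso_fromHomology_approxMap p hp.surjective
    apply isIso_of_isIso_homology_map p hp
    have h := homology_map_comp_fromHomology φ (approxMap p)
    rw [hφ] at h
    rw [show (homology R).map φ = 𝟙 _ by rw [← cancel_mono (fromHomology (approxMap p)), h,
      Category.id_comp]]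
    infer_instance

/-- A finitely generated free module surjects onto `N`.  It has a submodule which is minimal
among those mapping onto `N`, and this submodule is projective because the ring is hereditary. -/
theorem exists_isProjCover [IsNoetherianRing R] [IsArtinianRing R]
    (hR : SubmodulesProjective R R) (N : ModuleCat.{u} R) (hN : fgModules R N) :
    ∃ (P : ModuleCat.{u} R) (p : P ⟶ N), IsProjCover p := by
  have : Module.Finite R N := hN
  obtain ⟨n, f, hf⟩ := Module.Finite.exists_fin' R N
  obtain ⟨U, hU, hmin⟩ := WellFounded.has_min
    (wellFounded_lt : WellFounded ((· < ·) : Submodule R (Fin n → R) → _ → Prop))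
    {U | U.map f = ⊤} ⟨⊤, by
      change Submodule.map f ⊤ = ⊤
      rw [Submodule.map_top, LinearMap.range_eq_top.2 hf]⟩
  refine ⟨ModuleCat.of R U, ModuleCat.ofHom (f ∘ₗ U.subtype), ?_, ?_, ?_, ?_⟩
  · exact inferInstanceAs (Module.Finite R U)
  · exact (SubmodulesProjective.pi (fun _ => hR)) U
  · intro y
    obtain ⟨x, hx, rfl⟩ := (show U.map f = ⊤ from hU).ge (Submodule.mem_top (x := y))
    exact ⟨⟨x, hx⟩, rfl⟩
  · intro W hW
    change W ⊔ LinearMap.ker (f ∘ₗ U.subtype) = ⊤ at hW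
    have h : W.map U.subtype = U := by
      by_contra hne
      refine hmin (W.map U.subtype) ?_ (lt_of_le_of_ne (Submodule.map_subtype_le U W) hne)
      change (W.map U.subtype).map f = ⊤
      rw [← Submodule.map_comp]
      have := congrArg (Submodule.map (f ∘ₗ U.subtype)) hW
      rw [Submodule.map_sup, LinearMap.le_ker_iff_map.1 le_rfl, sup_bot_eq] at this
      rw [this, Submodule.map_comp, Submodule.map_subtype_top]
      exact hU
    rw [eq_top_iff]
    rintro ⟨x, hx⟩ -
    obtain ⟨y, hy, hxy⟩ := h.ge hx
    exact (show y = ⟨x, hx⟩ from Subtype.ext hxy) ▸ hy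

end Approximation

/-! ### Indecomposable objects -/

section Indecomposable

theorem eq_id_of_idempotent_of_isIso {C : Type*} [Category* C] {X : C} {e : X ⟶ X}
    (he : e ≫ e = e) [IsIso e] : e = 𝟙 X := by
  rwa [← cancel_epi e, Category.comp_id]

theorem eq_zero_of_idempotent_of_isIso_sub {C : Type*} [Category* C] [Preadditive C] {X : C}
    {e : X ⟶ X} (he : e ≫ e = e) [IsIso (𝟙 X - e)] : e = 0 := by
  have h : (𝟙 X - e) ≫ (𝟙 X - e) = 𝟙 X - e := by
    simp [Preadditive.sub_comp, Preadditive.comp_sub, he]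
  exact sub_eq_self.1 (eq_id_of_idempotent_of_isIso h)

theorem indecomposable_of_isIso {C : Type*} [Category* C] [Preadditive C]
    [Limits.HasBinaryBiproducts C] {X : C} (h0 : ¬ Limits.IsZero X)
    (h : ∀ e : X ⟶ X, e ≫ e = e → IsIso e ∨ IsIso (𝟙 X - e)) : Indecomposable X := by
  refine ⟨h0, fun Y Z i => ?_⟩
  have he : (i.hom ≫ Limits.biprod.fst ≫ Limits.biprod.inl ≫ i.inv) ≫
      (i.hom ≫ Limits.biprod.fst ≫ Limits.biprod.inl ≫ i.inv) =
      i.hom ≫ Limits.biprod.fst ≫ Limits.biprod.inl ≫ i.inv := by simp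
  rcases h _ he with hi | hi
  · right
    have h1 := eq_id_of_idempotent_of_isIso he
    rw [Limits.IsZero.iff_id_eq_zero]
    calc 𝟙 Z = Limits.biprod.inr ≫ i.inv ≫ 𝟙 X ≫ i.hom ≫ Limits.biprod.snd := by simp
      _ = 0 := by rw [← h1]; simp
  · left
    have h1 := eq_zero_of_idempotent_of_isIso_sub he
    rw [Limits.IsZero.iff_id_eq_zero]
    calc 𝟙 Y = Limits.biprod.inl ≫ i.inv ≫
        (i.hom ≫ Limits.biprod.fst ≫ Limits.biprod.inl ≫ i.inv) ≫ i.hom ≫ Limits.biprod.fst := by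
          simp
      _ = 0 := by rw [h1]; simp

theorem CategoryTheory.Indecomposable.of_iso {C : Type*} [Category* C]
    [Limits.HasZeroMorphisms C] [Limits.HasBinaryBiproducts C] {X Y : C} (h : Indecomposable X)
    (e : X ≅ Y) : Indecomposable Y :=
  ⟨fun h0 => h.1 (h0.of_iso e), fun A B i => h.2 A B (e ≪≫ i)⟩

/-- The endomorphism ring of an indecomposable module of finite length is local, by the Fitting
decomposition. -/
theorem CategoryTheory.Indecomposable.isIso_or_isIso_sub {S : Type u} [Ring S]
    {M : ModuleCat.{v} S} [IsNoetherian S M] [IsArtinian S M] (h : Indecomposable M)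
    (φ : M ⟶ M) : IsIso φ ∨ IsIso (𝟙 M - φ) := by
  let f : Module.End S M := φ.hom
  obtain ⟨n, hn, hn0⟩ := (f.eventually_isCompl_ker_pow_range_pow.and
    (Filter.eventually_ne_atTop 0)).exists
  have i : M ≅ ModuleCat.of S (LinearMap.ker (f ^ n)) ⊞ ModuleCat.of S (LinearMap.range (f ^ n)) :=
    (Submodule.prodEquivOfIsCompl _ _ hn).symm.toModuleIso ≪≫
      (ModuleCat.biprodIsoProd (ModuleCat.of S (LinearMap.ker (f ^ n)))
        (ModuleCat.of S (LinearMap.range (f ^ n)))).symm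
  rcases h.2 _ _ i with h0 | h0
  · left
    have h1 : LinearMap.ker (f ^ n) = ⊥ :=
      (Submodule.subsingleton_iff_eq_bot).1 (ModuleCat.subsingleton_of_isZero h0)
    have h2 : LinearMap.ker f = ⊥ := by
      rw [eq_bot_iff, ← h1]
      obtain ⟨m, rfl⟩ := Nat.exists_eq_succ_of_ne_zero hn0
      intro x hx
      rw [LinearMap.mem_ker] at hx ⊢
      rw [pow_succ, Module.End.mul_apply, hx, map_zero]
    rw [ConcreteCategory.isIso_iff_bijective]
    exact IsArtinian.bijective_of_injective_endomorphism f (LinearMap.ker_eq_bot.1 h2)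
  · right
    have h1 : LinearMap.range (f ^ n) = ⊥ :=
      (Submodule.subsingleton_iff_eq_bot).1 (ModuleCat.subsingleton_of_isZero h0)
    have h2 : IsNilpotent f := ⟨n, LinearMap.range_eq_bot.1 h1⟩
    rw [ConcreteCategory.isIso_iff_bijective]
    exact (Module.End.isUnit_iff _).1 h2.isUnit_one_sub

end Indecomposable

/-! ### Minimal approximations and isomorphisms -/

section MinimalApprox

variable {C : Type u} [Category.{v} C] {L : ObjectProperty C}

/-- Minimal right approximations of the same object are isomorphic. -/
theorem IsMinimalRightApprox.nonempty_iso {X X' M : C} {g : X ⟶ M} {g' : X' ⟶ M}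
    (h : IsMinimalRightApprox L g) (h' : IsMinimalRightApprox L g') : Nonempty (X ≅ X') := by
  obtain ⟨a, ha⟩ := h'.factors h.mem g
  obtain ⟨b, hb⟩ := h.factors h'.mem g'
  have h1 : IsIso (a ≫ b) := h.minimal _ (by rw [Category.assoc, hb, ha])
  have h2 : IsIso (b ≫ a) := h'.minimal _ (by rw [Category.assoc, ha, hb])
  have : IsIso a := by
    have : IsSplitMono a := ⟨⟨⟨b ≫ inv (a ≫ b), by rw [← Category.assoc, IsIso.hom_inv_id]⟩⟩⟩
    have : IsSplitEpi a := ⟨⟨⟨inv (b ≫ a) ≫ b, by rw [Category.assoc, IsIso.inv_hom_id]⟩⟩⟩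
    exact isIso_of_mono_of_isSplitEpi a
  exact ⟨asIso a⟩

theorem IsMinimalRightApprox.of_iso {X X' M : C} {g : X ⟶ M} (h : IsMinimalRightApprox L g)
    (e : X ≅ X') (hX' : L X') : IsMinimalRightApprox L (e.inv ≫ g) where
  mem := hX'
  factors Y hY f := by
    obtain ⟨f', hf'⟩ := h.factors hY f
    exact ⟨f' ≫ e.hom, by simp [hf']⟩
  minimal φ hφ := by
    have h1 : IsIso (e.hom ≫ φ ≫ e.inv) := h.minimal _ (by simp [hφ])
    have h2 : φ = e.inv ≫ (e.hom ≫ φ ≫ e.inv) ≫ e.hom := by simp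
    rw [h2]
    infer_instance

theorem IsMinimalRightApprox.comp_iso {X M M' : C} {g : X ⟶ M} (h : IsMinimalRightApprox L g)
    (e : M ≅ M') : IsMinimalRightApprox L (g ≫ e.hom) where
  mem := h.mem
  factors Y hY f := by
    obtain ⟨f', hf'⟩ := h.factors hY (f ≫ e.inv)
    exact ⟨f', by rw [← Category.assoc, hf', Category.assoc, e.inv_hom_id, Category.comp_id]⟩
  minimal φ hφ := h.minimal φ (by rwa [← Category.assoc, cancel_mono] at hφ)

theorem torsionless.of_iso {S : Type u} [Ring S] {M M' : ModuleCat.{u} S} (h : torsionless S M)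
    (e : M ≅ M') : torsionless S M' := by
  obtain ⟨_, P, f, hP, hf⟩ := h
  exact ⟨Module.Finite.equiv e.toLinearEquiv, P, f ∘ₗ e.toLinearEquiv.symm.toLinearMap, hP,
    hf.comp e.toLinearEquiv.symm.injective⟩

theorem indecTorsionlessNonproj.of_iso {S : Type u} [Ring S] {M M' : ModuleCat.{u} S}
    (h : indecTorsionlessNonproj S M) (e : M ≅ M') : indecTorsionlessNonproj S M' :=
  ⟨h.1.of_iso e, fun _ => h.2.1 (Module.Projective.of_equiv e.toLinearEquiv.symm), h.2.2.of_iso e⟩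

end MinimalApprox

/-! ### The bijection between indecomposable modules -/

section Bijection

variable {R : Type u} [Ring R]

theorem homology_map_id_sub {M : ModuleCat.{v} R[ε]} (φ : M ⟶ M) :
    (homology R).map (𝟙 M - φ) = 𝟙 _ - (homology R).map φ := by
  ext x
  obtain ⟨z, rfl⟩ := Submodule.mkQ_surjective _ x
  rfl

/-- Projective `R[ε]`-modules have no homology, since this holds for free ones. -/
theorem ker_differential_le_range_of_projective {X : ModuleCat.{u} R[ε]}
    (hX : Module.Projective R[ε] X) :
    LinearMap.ker (differential X) ≤ LinearMap.range (differential X) := by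
  obtain ⟨s, hs⟩ := Module.projective_def'.1 hX
  intro x hx
  let x' : X := x
  have hx' : (ε : R[ε]) • x' = 0 := hx
  have h0 : ∀ i, s x' i = ε * dualInl R (s x' i).snd := fun i => by
    have h1 : (ε : R[ε]) * s x' i = 0 := by
      have h2 : s ((ε : R[ε]) • x') = 0 := by rw [hx', map_zero]
      rw [map_smul] at h2
      exact DFunLike.congr_fun h2 i
    have h3 : (s x' i).fst = 0 := by
      have := congrArg TrivSqZeroExt.snd h1
      simpa using this
    ext
    · simp [h3]
    · simp [dualInl]
  refine ⟨((s x').sum fun i a => dualInl R a.snd • i : X), ?_⟩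
  change (ε : R[ε]) • ((s x').sum fun i a => dualInl R a.snd • i : X) = x'
  rw [Finsupp.smul_sum]
  refine Eq.trans (Finset.sum_congr rfl fun i _ => ?_) (LinearMap.congr_fun hs x')
  change (ε : R[ε]) • dualInl R (s x' i).snd • i = s x' i • i
  rw [← mul_smul, ← h0]

theorem isZero_homology_iff (M : ModuleCat.{v} R[ε]) :
    Limits.IsZero ((homology R).obj M) ↔
      LinearMap.ker (differential M) ≤ LinearMap.range (differential M) := by
  constructor
  · intro h x hx
    have := ModuleCat.subsingleton_of_isZero h
    have h1 : (boundaries M).mkQ ⟨x, hx⟩ = 0 :=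
      Subsingleton.elim (α := (homology R).obj M) _ _
    rw [← LinearMap.mem_ker, Submodule.ker_mkQ] at h1
    exact h1
  · intro h
    rw [ModuleCat.isZero_iff_subsingleton]
    refine ⟨fun x y => ?_⟩
    have key : ∀ x : (homology R).obj M, x = 0 := fun x => by
      obtain ⟨z, rfl⟩ := Submodule.mkQ_surjective _ x
      have : z ∈ LinearMap.ker (boundaries M).mkQ := by
        rw [Submodule.ker_mkQ]
        exact h z.2
      exact this
    rw [key x, key y]

theorem not_isZero_homology (hR : SubmodulesProjective R R) {M : ModuleCat.{u} R[ε]} (hM : torsionless R[ε] M)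
    (hM' : ¬ Module.Projective R[ε] M) : ¬ Limits.IsZero ((homology R).obj M) := fun h =>
  hM' (projective_of_exact (hM.submodulesProjective hR) ((isZero_homology_iff M).1 h))

/-- The approximation of `H(M)` is a direct summand of `M`: by fullness there are maps `u` from it
to `M` and `v` back such that `u ≫ v` is the identity on homology, hence invertible. -/
theorem nonempty_approxObj_iso [IsNoetherianRing R] [IsArtinianRing R]
    [IsNoetherianRing R[ε]] [IsArtinianRing R[ε]] (hR : SubmodulesProjective R R) {M : ModuleCat.{u} R[ε]}
    (hM : indecTorsionlessNonproj R[ε] M) {P : ModuleCat.{u} R} {p : P ⟶ (homology R).obj M}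
    (hp : IsProjCover p) : Nonempty (approxObj p ≅ M) := by
  have := hp.finite
  have := hp.projective
  have := isIso_fromHomology_approxMap p hp.surjective
  have hMR := hM.1.submodulesProjective hR
  obtain ⟨f, hf⟩ := exists_fromHomology_eq hMR (𝟙 ((homology R).obj M))
  obtain ⟨v, hv⟩ := exists_lift_approxMap p hp.surjective hMR.projective f
  obtain ⟨u, hu⟩ := exists_homology_map_eq (M' := M)
    ((torsionless_approxObj p).submodulesProjective hR) (fromHomology (approxMap p))
  have huv : IsIso (u ≫ v) := by
    apply isIso_of_isIso_homology_map p hp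
    have : (homology R).map (u ≫ v) = 𝟙 _ := by
      rw [← cancel_mono (fromHomology (approxMap p)), Functor.map_comp, Category.assoc,
        homology_map_comp_fromHomology, hv, hf, hu, Category.comp_id, Category.id_comp]
    rw [this]
    infer_instance
  have he : (v ≫ inv (u ≫ v) ≫ u) ≫ (v ≫ inv (u ≫ v) ≫ u) = v ≫ inv (u ≫ v) ≫ u := by
    have := IsIso.inv_hom_id (u ≫ v)
    simp only [Category.assoc] at this ⊢
    rw [reassoc_of% this]
  have := hM.1.1
  have : IsArtinian R[ε] M := inferInstance
  rcases hM.2.2.isIso_or_isIso_sub (v ≫ inv (u ≫ v) ≫ u) with h | h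
  · have h1 := eq_id_of_idempotent_of_isIso he
    exact ⟨⟨u, v ≫ inv (u ≫ v), by rw [← Category.assoc, IsIso.hom_inv_id],
      by rw [Category.assoc, h1]⟩⟩
  · exfalso
    have h1 := eq_zero_of_idempotent_of_isIso_sub he
    have h2 : u = 0 := by
      have : u ≫ v ≫ inv (u ≫ v) ≫ u = u := by
        rw [← Category.assoc, ← Category.assoc, IsIso.hom_inv_id, Category.id_comp]
      rw [← this, h1, Limits.comp_zero]
    apply not_isZero_homology hR hM.1 hM.2.1
    have h3 : (homology R).map u = 0 := by
      rw [h2]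
      ext x
      obtain ⟨z, rfl⟩ := Submodule.mkQ_surjective _ x
      rfl
    rw [Limits.IsZero.iff_id_eq_zero]
    calc 𝟙 _ = inv (fromHomology (approxMap p)) ≫ fromHomology (approxMap p) := by simp
      _ = 0 := (congrArg (inv (fromHomology (approxMap p)) ≫ ·) (hu.symm.trans h3)).trans
        Limits.comp_zero

/-- An idempotent endomorphism of `H(M)` lifts to an endomorphism `φ` of `M`, and `φ` or `1 - φ` is
invertible. -/
theorem indecFG_homology [IsNoetherianRing R] [IsNoetherianRing R[ε]] [IsArtinianRing R[ε]]
    (hR : SubmodulesProjective R R) {M : ModuleCat.{u} R[ε]}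
    (hM : indecTorsionlessNonproj R[ε] M) : indecFG R ((homology R).obj M) := by
  have := hM.1.1
  refine ⟨fgModules_homology M hM.1.1, indecomposable_of_isIso
    (not_isZero_homology hR hM.1 hM.2.1) fun e _ => ?_⟩
  obtain ⟨φ, rfl⟩ := exists_homology_map_eq (hM.1.submodulesProjective hR) e
  have : IsArtinian R[ε] M := inferInstance
  rcases hM.2.2.isIso_or_isIso_sub φ with h | h
  · left
    infer_instance
  · right
    rw [← homology_map_id_sub]
    infer_instance

/-- Endomorphisms of `P ⊕ Ω` which are invertible on homology are invertible, so `P ⊕ Ω` inherits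
indecomposability from its homology `N`. -/
theorem indecTorsionlessNonproj_approxObj [IsNoetherianRing R] [IsArtinianRing R] {P N : ModuleCat.{u} R} {p : P ⟶ N}
    (hp : IsProjCover p) (hN : indecFG R N) : indecTorsionlessNonproj R[ε] (approxObj p) := by
  have := hp.finite
  have := hp.projective
  have := isIso_fromHomology_approxMap p hp.surjective
  have hH : ¬ Limits.IsZero ((homology R).obj (approxObj p)) := fun h =>
    hN.2.1 (h.of_iso (asIso (fromHomology (approxMap p))).symm)
  refine ⟨torsionless_approxObj p,
    fun h => hH ((isZero_homology_iff _).2 (ker_differential_le_range_of_projective h)),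
    indecomposable_of_isIso (fun h => ?_) fun e _ => ?_⟩
  · apply hH
    rw [isZero_homology_iff]
    have := ModuleCat.subsingleton_of_isZero h
    have : Subsingleton ((underlying R).obj (approxObj p)) := this
    intro x _
    rw [Subsingleton.elim x 0]
    exact zero_mem _
  · have : Module.Finite R N := hN.1
    have : IsArtinian R N := inferInstance
    have hH' : Indecomposable ((homology R).obj (approxObj p)) :=
      hN.2.of_iso (asIso (fromHomology (approxMap p))).symm
    have : Module.Finite R[ε] (approxObj p) := (torsionless_approxObj p).1
    have : Module.Finite R ((homology R).obj (approxObj p)) := fgModules_homology _ this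
    have : IsArtinian R ((homology R).obj (approxObj p)) := inferInstance
    rcases hH'.isIso_or_isIso_sub ((homology R).map e) with h | h
    · exact .inl (isIso_of_isIso_homology_map p hp _ h)
    · rw [← homology_map_id_sub] at h
      exact .inr (isIso_of_isIso_homology_map p hp _ h)

theorem bijOn_mapIsoClass_homology [IsNoetherianRing R] [IsArtinianRing R] [IsNoetherianRing R[ε]]
    [IsArtinianRing R[ε]] (hR : SubmodulesProjective R R) :
    Set.BijOn (mapIsoClass (homology.{u, u} R)) (isoClasses (indecTorsionlessNonproj R[ε]))
      (isoClasses (indecFG R)) := by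
  refine ⟨?_, ?_, ?_⟩
  · rintro _ ⟨M, hM, rfl⟩
    exact ⟨_, indecFG_homology hR hM, rfl⟩
  · rintro _ ⟨M, hM, rfl⟩ _ ⟨M', hM', rfl⟩ h
    obtain ⟨e⟩ : Nonempty ((homology R).obj M ≅ (homology R).obj M') := Quotient.exact h
    obtain ⟨P, p, hp⟩ := exists_isProjCover hR _ (indecFG_homology hR hM).1
    obtain ⟨P', p', hp'⟩ := exists_isProjCover hR _ (indecFG_homology hR hM').1
    obtain ⟨i⟩ := nonempty_approxObj_iso hR hM hp
    obtain ⟨i'⟩ := nonempty_approxObj_iso hR hM' hp'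
    obtain ⟨j⟩ := ((isMinimalRightApprox_approxMap p hR hp).comp_iso
      ((trivialDiff R).mapIso e)).nonempty_iso (isMinimalRightApprox_approxMap p' hR hp')
    exact Quotient.sound ⟨i.symm ≪≫ j ≪≫ i'⟩
  · rintro _ ⟨N, hN, rfl⟩
    obtain ⟨P, p, hp⟩ := exists_isProjCover hR N hN.1
    have := isIso_fromHomology_approxMap p hp.surjective
    exact ⟨_, ⟨approxObj p, indecTorsionlessNonproj_approxObj hp hN, rfl⟩,
      Quotient.sound ⟨asIso (fromHomology (approxMap p))⟩⟩

/-- Every pushout of `P` and `Ω[ε]` along `Ω` is isomorphic, over `N`, to `P ⊕ Ω`. -/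
theorem isMinimalRightApprox_of_isPushout [IsNoetherianRing R] [IsArtinianRing R]
    (hR : SubmodulesProjective R R) {N P : ModuleCat.{u} R} {p : P ⟶ N} (hp : IsProjCover p)
    {X : ModuleCat.{u} R[ε]} {i : (trivialDiff R).obj P ⟶ X}
    {j : dualMod (ModuleCat.of R (LinearMap.ker p.hom)) ⟶ X} {g : X ⟶ (trivialDiff R).obj N}
    (h : IsPushout ((trivialDiff R).map (ModuleCat.ofHom (LinearMap.ker p.hom).subtype))
      (toDualMod (ModuleCat.of R (LinearMap.ker p.hom))) i j)
    (hi : i ≫ g = (trivialDiff R).map p) (hj : j ≫ g = 0) :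
    IsMinimalRightApprox (torsionless R[ε]) g := by
  have hmin := isMinimalRightApprox_approxMap p hR hp
  let e := (isPushout_approx p).isoIsPushout _ _ h
  have hg : g = e.inv ≫ approxMap p := by
    apply h.hom_ext
    · rw [hi, IsPushout.inl_isoIsPushout_inv_assoc, approxInl_comp_approxMap]
    · rw [hj, IsPushout.inr_isoIsPushout_inv_assoc, approxInr_comp_approxMap]
  rw [hg]
  exact hmin.of_iso e (hmin.mem.of_iso e)

end Bijection

/-! ### Dual numbers over the path algebra of a finite acyclic quiver -/

instance Opposite.instFintype (V : Type v) [Fintype V] : Fintype Vᵒᵖ :=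
  Fintype.ofEquiv V Opposite.equivToOpposite

theorem Quiver.finite_hom_op {V : Type v} [Quiver.{w} V] [∀ a b : V, Finite (a ⟶ b)]
    (a b : Vᵒᵖ) : Finite (a ⟶ b) :=
  Finite.of_injective (fun f : a ⟶ b => f.unop) Quiver.Hom.unop_inj

namespace PathAlgebra

variable (k : Type u) [Field k] (V : Type v) [Quiver.{w} V] [Fintype V]

attribute [local instance] RingHomInvPair.of_ringEquiv in
/-- The right module `kV[ε]` corresponds to the left module given by the opposite quiver. -/
def dualNumberOpSemilinearEquiv :
    ModuleCat.of ((PathAlgebra k V)[ε])ᵐᵒᵖ (PathAlgebra k V)[ε]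
      ≃ₛₗ[RingHomClass.toRingHom (dualNumberOpEquiv k V)]
      ModuleCat.of (PathAlgebra k Vᵒᵖ)[ε] (PathAlgebra k Vᵒᵖ)[ε] :=
  { (MulOpposite.opAddEquiv.trans (dualNumberOpEquiv k V).toAddEquiv :
      (PathAlgebra k V)[ε] ≃+ (PathAlgebra k Vᵒᵖ)[ε]) with
    map_smul' := fun r x => map_mul (dualNumberOpEquiv k V) r (.op x) }

attribute [local instance] RingHomInvPair.of_ringEquiv in
theorem isOneGorenstein [∀ a b : V, Finite (a ⟶ b)] (hV : QuiverAcyclic V) :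
    IsOneGorenstein k (PathAlgebra k V)[ε] where
  finite :=
    have := finite_of_acyclic (k := k) hV
    inferInstanceAs (Module.Finite k (PathAlgebra k V × PathAlgebra k V))
  left := (submodulesProjective hV).hasInjectiveDimensionLE_dualNumber
  right :=
    have : ∀ a b : Vᵒᵖ, Finite (a ⟶ b) := Quiver.finite_hom_op
    (ModuleCat.hasInjectiveDimensionLE_iff_of_semiLinearEquiv (dualNumberOpEquiv k V)
      (dualNumberOpSemilinearEquiv k V) 1).2
      (submodulesProjective hV.op).hasInjectiveDimensionLE_dualNumber

variable {k V}

/-- Right multiplication by an arrow `a ⟶ b` is injective on `(kV) e_b`. -/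
theorem mul_idem_eq_zero_of_mul_toPath_eq_zero {a b : V} (α : a ⟶ b) (x : PathAlgebra k V)
    (h : x * ofPath α.toPath = 0) : x * idem k b = 0 := by
  refine ext_coeff ?_
  rintro ⟨d, c, p⟩
  rw [map_zero]
  by_cases hd : b = d
  · subst hd
    rw [← coeff_mul_toPath α, mul_assoc, ofPath_mul_ofPath, Quiver.Path.comp_nil, h, map_zero]
  · exact coeff_mul_idem _ _ hd

/-- A product with an arrow as left factor involves only paths of positive length. -/
theorem coeff_nil_toPath_mul {a b c : V} (α : a ⟶ b) (y : PathAlgebra k V) :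
    coeff ⟨c, c, .nil⟩ (ofPath α.toPath * y) = 0 := by
  induction y using induction_on with
  | h0 => rw [mul_zero', map_zero]
  | hadd x y hx hy => rw [mul_add', map_add, hx, hy, add_zero]
  | hp r q =>
    rename_i d e
    rw [mul_smul', map_smul]
    by_cases he : e = a
    · subst he
      rw [ofPath_mul_ofPath, coeff_ofPath_of_ne, smul_zero]
      intro h
      have := congrArg (fun p : (Σ a b : V, Quiver.Path a b) => p.2.2.length) h
      simp at this
    · rw [ofPath_mul_ofPath_of_ne _ _ he, map_zero, smul_zero]

/-- For an arrow `α : a ⟶ b`, the map `x α ↦ x e_b` on the left ideal generated by `α` does not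
extend to the whole algebra. -/
theorem not_injective_dualNumber {a b : V} (α : a ⟶ b) :
    ¬ Module.Injective (PathAlgebra k V)[ε] (PathAlgebra k V)[ε] := fun _ => by
  obtain ⟨y, hy⟩ := exists_smul_eq_of_injective (S := (PathAlgebra k V)[ε])
    (dualInl _ (ofPath α.toPath)) (dualInl _ (idem k b)) fun x hx => by
      have h1 : x.fst * ofPath α.toPath = 0 := by
        simpa [dualInl] using congrArg TrivSqZeroExt.fst hx
      have h2 : x.snd * ofPath α.toPath = 0 := by
        simpa [dualInl] using congrArg TrivSqZeroExt.snd hx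
      ext
      · simpa [dualInl] using mul_idem_eq_zero_of_mul_toPath_eq_zero α _ h1
      · simpa [dualInl] using mul_idem_eq_zero_of_mul_toPath_eq_zero α _ h2
  have h1 : ofPath α.toPath * y.fst = idem k b := by
    simpa [dualInl] using congrArg TrivSqZeroExt.fst hy
  have h2 := coeff_nil_toPath_mul (c := b) α y.fst
  rw [h1, coeff_ofPath_self] at h2
  exact one_ne_zero h2

theorem injectiveDimension_dualNumber [∀ a b : V, Finite (a ⟶ b)] (hV : QuiverAcyclic V) {a b : V}
    (α : a ⟶ b) :
    injectiveDimension (ModuleCat.of (PathAlgebra k V)[ε] (PathAlgebra k V)[ε]) = 1 := by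
  apply le_antisymm
  · exact (injectiveDimension_le_iff _ 1).2
      (submodulesProjective hV).hasInjectiveDimensionLE_dualNumber
  · refine (injectiveDimension_ge_iff _ 1).2 fun h => not_injective_dualNumber (k := k) α ?_
    exact Module.injective_module_of_injective_object _ _

attribute [local instance] RingHomInvPair.of_ringEquiv in
theorem injectiveDimension_dualNumber_op [∀ a b : V, Finite (a ⟶ b)] (hV : QuiverAcyclic V)
    {a b : V} (α : a ⟶ b) :
    injectiveDimension (ModuleCat.of ((PathAlgebra k V)[ε])ᵐᵒᵖ (PathAlgebra k V)[ε]) = 1 :=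
  have : ∀ a b : Vᵒᵖ, Finite (a ⟶ b) := Quiver.finite_hom_op
  (ModuleCat.injectiveDimension_eq_of_semiLinearEquiv (dualNumberOpEquiv k V)
    (dualNumberOpSemilinearEquiv k V)).trans (injectiveDimension_dualNumber hV.op α.op)

end PathAlgebra

end

theorem theorem2 (k : Type u) [Field k] (V : Type v) [Quiver.{w} V] [Fintype V]
    [∀ a b : V, Finite (a ⟶ b)] (hV : QuiverAcyclic V) :
    -- `Λ = kV[ε]` is `1`-Gorenstein
    IsOneGorenstein k (PathAlgebra k V)[ε] ∧
    -- (both injective dimensions are equal to `1` as soon as the quiver has an arrow)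
    ((∃ a b : V, Nonempty (a ⟶ b)) →
      injectiveDimension (ModuleCat.of (PathAlgebra k V)[ε] (PathAlgebra k V)[ε]) = 1 ∧
      injectiveDimension (ModuleCat.of ((PathAlgebra k V)[ε])ᵐᵒᵖ (PathAlgebra k V)[ε]) = 1) ∧
    -- `H` sends `mod Λ` to `mod kV`, and its restriction to the torsionless modules is full
    (∀ M : ModuleCat.{max u v w} (PathAlgebra k V)[ε],
      fgModules _ M → fgModules _ ((homology (PathAlgebra k V)).obj M)) ∧
    ((torsionless (PathAlgebra k V)[ε]).ι ⋙ homology (PathAlgebra k V)).Full ∧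
    -- `H` induces a bijection on isomorphism classes of indecomposables
    Set.BijOn (mapIsoClass (homology.{max u v w, max u v w} (PathAlgebra k V)))
      (isoClasses (indecTorsionlessNonproj (PathAlgebra k V)[ε]))
      (isoClasses (indecFG (PathAlgebra k V))) ∧
    -- every finitely generated `kV`-module has a minimal right approximation by torsionless
    -- `Λ`-modules, and these approximations give the inverse bijection
    (∀ N : ModuleCat.{max u v w} (PathAlgebra k V), fgModules _ N →
      ∃ (X : ModuleCat.{max u v w} (PathAlgebra k V)[ε]) (g : X ⟶ (trivialDiff _).obj N),
        IsMinimalRightApprox (torsionless (PathAlgebra k V)[ε]) g) ∧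
    (∀ (N : ModuleCat.{max u v w} (PathAlgebra k V))
        (X : ModuleCat.{max u v w} (PathAlgebra k V)[ε]) (g : X ⟶ (trivialDiff _).obj N),
      indecFG _ N → IsMinimalRightApprox (torsionless (PathAlgebra k V)[ε]) g →
        indecTorsionlessNonproj _ X ∧ Nonempty ((homology (PathAlgebra k V)).obj X ≅ N)) ∧
    (∀ (M X : ModuleCat.{max u v w} (PathAlgebra k V)[ε])
        (g : X ⟶ (trivialDiff _).obj ((homology (PathAlgebra k V)).obj M)),
      indecTorsionlessNonproj _ M →
        IsMinimalRightApprox (torsionless (PathAlgebra k V)[ε]) g → Nonempty (X ≅ M)) ∧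
    -- the minimal right approximation of `N` is the pushout of `P₀ N` and `(Ω₀ N)[ε]` along
    -- `Ω₀ N`, where `P₀ N → N` is a projective cover with kernel `Ω₀ N`
    (∀ N : ModuleCat.{max u v w} (PathAlgebra k V), fgModules _ N →
      ∃ (P : ModuleCat.{max u v w} (PathAlgebra k V)) (p : P ⟶ N), IsProjCover p) ∧
    (∀ (N P : ModuleCat.{max u v w} (PathAlgebra k V)) (p : P ⟶ N),
      IsProjCover p →
      ∀ (X : ModuleCat.{max u v w} (PathAlgebra k V)[ε])
        (i : (trivialDiff _).obj P ⟶ X)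
        (j : dualMod (ModuleCat.of (PathAlgebra k V) (LinearMap.ker p.hom)) ⟶ X)
        (g : X ⟶ (trivialDiff _).obj N),
        IsPushout ((trivialDiff _).map (ModuleCat.ofHom (LinearMap.ker p.hom).subtype))
          (toDualMod (ModuleCat.of (PathAlgebra k V) (LinearMap.ker p.hom))) i j →
        i ≫ g = (trivialDiff _).map p → j ≫ g = 0 →
          IsMinimalRightApprox (torsionless (PathAlgebra k V)[ε]) g) := by
  have hR := PathAlgebra.submodulesProjective (k := k) hV
  have hG := PathAlgebra.isOneGorenstein k V hV
  have := hG.finite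
  have := PathAlgebra.finite_of_acyclic (k := k) hV
  have : IsArtinianRing (PathAlgebra k V) := IsArtinianRing.of_finite k _
  have : IsNoetherianRing (PathAlgebra k V) := IsNoetherianRing.of_finite k _
  have : IsScalarTower k (PathAlgebra k V)[ε] (PathAlgebra k V)[ε] :=
    ⟨fun a x y => Algebra.smul_mul_assoc a x y⟩
  have : IsArtinianRing (PathAlgebra k V)[ε] := IsArtinianRing.of_finite k _
  have : IsNoetherianRing (PathAlgebra k V)[ε] := IsNoetherianRing.of_finite k _
  refine ⟨hG, ?_, fgModules_homology, ?_, bijOn_mapIsoClass_homology hR, ?_, ?_, ?_,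
    exists_isProjCover hR, ?_⟩
  · rintro ⟨a, b, ⟨α⟩⟩
    exact ⟨PathAlgebra.injectiveDimension_dualNumber hV α,
      PathAlgebra.injectiveDimension_dualNumber_op hV α⟩
  · refine ⟨fun {M M'} φ => ?_⟩
    obtain ⟨f, hf⟩ := exists_homology_map_eq (M' := M'.obj) (M.2.submodulesProjective hR) φ
    exact ⟨ObjectProperty.homMk f, hf⟩
  · intro N hN
    obtain ⟨P, p, hp⟩ := exists_isProjCover hR N hN
    exact ⟨approxObj p, approxMap p, isMinimalRightApprox_approxMap p hR hp⟩
  · intro N X g hN hg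
    obtain ⟨P, p, hp⟩ := exists_isProjCover hR N hN.1
    have := isIso_fromHomology_approxMap p hp.surjective
    obtain ⟨i⟩ := (isMinimalRightApprox_approxMap p hR hp).nonempty_iso hg
    exact ⟨(indecTorsionlessNonproj_approxObj hp hN).of_iso i,
      ⟨(homology _).mapIso i.symm ≪≫ asIso (fromHomology (approxMap p))⟩⟩
  · intro M X g hM hg
    obtain ⟨P, p, hp⟩ := exists_isProjCover hR _ (fgModules_homology M hM.1.1)
    obtain ⟨i⟩ := hg.nonempty_iso (isMinimalRightApprox_approxMap p hR hp)
    obtain ⟨j⟩ := nonempty_approxObj_iso hR hM hp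
    exact ⟨i ≪≫ j⟩
  · intro N P p hp X i j g h hi hj
    exact isMinimalRightApprox_of_isPushout hR hp h hi hj
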